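/- Let $X_1, X_2, \ldots$ be independent real random variables with partial sums $S_n = X_1+\cdots+X_n$, let $(d_k)_{k\ge1}$ be positive constants, and put $D_N=\sum_{k=1}^N d_k$, where $D_N\to\infty$. Assume that: $(C_1)$ for some numerical sequences $a_n>0$ and $b_n\in\mathbb{R}$, $S_n/a_n-b_n$ converges in law to $H$, where $H$ is some (possibly degenerate) probability distribution on $\mathbb{R}$; $(C_2)$ $kd_k=O(1)$ or $1/(kd_k)=O(1)$ as $k\to\infty$, and for some $0<\alpha<1$ the sequence $d_kk^\alpha$ is eventually non-increasing; $(C_3)$ for some $\rho>0$, $\displaystyle d_k=O\Big(\frac{D_k}{k(\log D_k)^\rho}\Big)$ as $k\to\infty$; $(C_4)$ there are positive constants $C,\beta$ with $a_k/a_l\le C(k/l)^\beta$ for all $1\le k\le l$, and, for some $0<r<\rho$ and some integer $\mu\ge\max\{2,\,4/(\rho-r)\}$, $\displaystyle\sup_{n\ge1}\mathbb{E}\Big|\frac{S_n}{a_n}-b_n\Big|^\mu<\infty$. Then for every Lipschitz function $f:\mathbb{R}\to\mathbb{R}$ (not necessarily bounded), $f$ is $H$-integrable and $$\lim_{N\to\infty}\frac1{D_N}\sum_{k=1}^N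 d_k f\Big(\frac{S_k}{a_k}-b_k\Big)=\int_{-\infty}^\infty f(x)\,dH(x)\quad\text{almost surely.}$$ -/

import Mathlib

open MeasureTheory ProbabilityTheory Filter Asymptotics
open scoped NNReal ENNReal Topology

/-- The partial sum `S_n` of the first `n` terms of the sequence `X 0, X 1, …`; the `i`-th random
variable of the sequence (counted from one) is `X (i - 1)`. -/
def partialSum {Ω : Type*} (X : ℕ → Ω → ℝ) (n : ℕ) (ω : Ω) : ℝ :=
  ∑ i ∈ Finset.range n, X i ω

/-- The normalized partial sum `S_n / a_n - b_n`. -/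
noncomputable def normSum {Ω : Type*} (X : ℕ → Ω → ℝ) (a b : ℕ → ℝ) (n : ℕ) (ω : Ω) : ℝ :=
  partialSum X n ω / a n - b n

/-- The total weight `D_N = d_1 + ⋯ + d_N`. -/
def totalWeight (d : ℕ → ℝ) (N : ℕ) : ℝ :=
  ∑ k ∈ Finset.Icc 1 N, d k

/-! Write `Z_k` for the normalized sum, `L = log D_N`, and let `q` be the integer part of `μ / 2`.
The core is a bound `A * D_N ^ (2q) * L ^ (-σ)`, for any `σ < ρ q`, on the `2q`-th moment of `∑ d_k
(f (Z_k) - E f (Z_k))` (`exists_integral_weighted_sum_pow_le`). To get it, cut the indices into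
geometric blocks `[R^j, R^(j+1))` and remove from `Z_k` the summands preceding the previous block.
Since `f` is Lipschitz and `a_t / a_k ≤ C (t/k)^β`, this costs a factor `R ^ (-β)`. Afterwards
blocks of equal parity are independent, and a Rosenthal-type inequality bounds the moment by a
constant times `(w * D_N) ^ q`, where `w` is the largest block weight. By (C₃), `w` is at most of
order `D_N * log R / L ^ ρ`. Taking `R` to be a suitable power of `L` makes both contributions
small. Since `ρ q > 1`, some `σ > 1` is allowed, and the bound is summable along indices where `D`
is about `exp (j ^ γ)` with `1/σ < γ < 1`. This gives almost sure convergence on the subsequence.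
For `f ≥ 0` the sums are monotone and consecutive values of `D` have ratio tending to one, so the
gaps fill in; general `f` splits into positive and negative parts. The means `E f (Z_k)` converge
because the second moments are bounded. -/

/-! ### Even moments of sums of independent centred variables. -/

/-- Second-order Taylor remainder of a power. The constant is not sharp; it closes the induction
through `(n+2)^2 + (n+2) ≤ (n+3)^2`. -/
theorem abs_add_pow_sub_le (n : ℕ) (a x : ℝ) :
    |(a + x) ^ (n + 2) - a ^ (n + 2) - (n + 2) * a ^ (n + 1) * x|
      ≤ (n + 2) ^ 2 * (|a| + |x|) ^ n * x ^ 2 := by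
  induction n with
  | zero =>
    have : (a + x) ^ (0 + 2) - a ^ (0 + 2) - ((0 : ℕ) + 2) * a ^ (0 + 1) * x = x ^ 2 := by
      push_cast; ring
    rw [this, abs_of_nonneg (sq_nonneg x)]
    norm_num
    nlinarith [sq_nonneg x]
  | succ n ih =>
    have e : (a + x) ^ (n + 1 + 2) - a ^ (n + 1 + 2) - ((n + 1 : ℕ) + 2) * a ^ (n + 1 + 1) * x
        = (a + x) * ((a + x) ^ (n + 2) - a ^ (n + 2) - (n + 2) * a ^ (n + 1) * x)
          + (n + 2) * a ^ (n + 1) * x ^ 2 := by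
      push_cast; ring
    rw [e]
    have hs : |a + x| ≤ |a| + |x| := abs_add_le a x
    have h0 : 0 ≤ |a| + |x| := by positivity
    have h1 : |a| ^ (n + 1) ≤ (|a| + |x|) ^ (n + 1) := by
      gcongr; linarith [abs_nonneg x]
    calc _ ≤ |a + x| * |(a + x) ^ (n + 2) - a ^ (n + 2) - (n + 2) * a ^ (n + 1) * x|
          + (n + 2) * |a| ^ (n + 1) * x ^ 2 := by
            refine (abs_add_le _ _).trans ?_
            rw [abs_mul, abs_mul, abs_mul, abs_pow, abs_of_nonneg (sq_nonneg x),
              abs_of_nonneg (by positivity : (0 : ℝ) ≤ n + 2)]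
      _ ≤ (|a| + |x|) * ((n + 2) ^ 2 * (|a| + |x|) ^ n * x ^ 2)
          + (n + 2) * (|a| + |x|) ^ (n + 1) * x ^ 2 := by gcongr
      _ = ((n + 2) ^ 2 + (n + 2)) * ((|a| + |x|) ^ (n + 1) * x ^ 2) := by ring
      _ ≤ ((n + 1 : ℕ) + 2) ^ 2 * ((|a| + |x|) ^ (n + 1) * x ^ 2) := by
            gcongr; push_cast; nlinarith
      _ = _ := by ring

/-- The linear term is kept exact because its expectation vanishes when `x` is centred and
independent of `a`. The constant depends on `q` only, so it serves all `i < q` at once. -/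
theorem add_pow_even_le {q i : ℕ} (hi : i + 1 ≤ q) (a x : ℝ) :
    (a + x) ^ (2 * (i + 1)) ≤ a ^ (2 * (i + 1)) + (2 * i + 2) * (a ^ (2 * i + 1) * x)
      + (2 * q) ^ 2 * 4 ^ q * (a ^ (2 * i) * x ^ 2 + x ^ (2 * (i + 1))) := by
  have h := (abs_le.1 (abs_add_pow_sub_le (2 * i) a x)).2
  have h2 : (|a| + |x|) ^ (2 * i) ≤ 4 ^ i * (a ^ (2 * i) + x ^ (2 * i)) := by
    have := add_pow_le (abs_nonneg a) (abs_nonneg x) (2 * i)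
    rw [Even.pow_abs (even_two_mul i), Even.pow_abs (even_two_mul i)] at this
    refine this.trans ?_
    have h3 : (2 : ℝ) ^ (2 * i - 1) ≤ 4 ^ i := by
      rw [show (4 : ℝ) = 2 ^ 2 by norm_num, ← pow_mul]
      exact pow_le_pow_right₀ (by norm_num) (by omega)
    have : 0 ≤ a ^ (2 * i) + x ^ (2 * i) := by
      have := (even_two_mul i).pow_nonneg a
      have := (even_two_mul i).pow_nonneg x
      linarith
    gcongr
  have hA : 0 ≤ a ^ (2 * i) := (even_two_mul i).pow_nonneg a
  have hB : 0 ≤ x ^ (2 * i) := (even_two_mul i).pow_nonneg x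
  have hiq : (i : ℝ) + 1 ≤ q := by exact_mod_cast hi
  have h4 : (((2 * i : ℕ) : ℝ) + 2) ^ 2 * (|a| + |x|) ^ (2 * i) * x ^ 2
      ≤ (2 * q) ^ 2 * 4 ^ q * (a ^ (2 * i) * x ^ 2 + x ^ (2 * (i + 1))) := by
    have e : a ^ (2 * i) * x ^ 2 + x ^ (2 * (i + 1)) = (a ^ (2 * i) + x ^ (2 * i)) * x ^ 2 := by
      ring
    rw [e, ← mul_assoc]
    gcongr ?_ * _
    rw [mul_assoc]
    have h5 : (((2 * i : ℕ) : ℝ) + 2) ^ 2 ≤ (2 * q) ^ 2 := by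
      push_cast; gcongr; linarith
    have h6 : (4 : ℝ) ^ i ≤ 4 ^ q := pow_le_pow_right₀ (by norm_num) (by omega)
    calc _ ≤ (2 * (q : ℝ)) ^ 2 * (4 ^ i * (a ^ (2 * i) + x ^ (2 * i))) := by gcongr
      _ ≤ _ := by gcongr
  have e2 : 2 * (i + 1) = 2 * i + 2 := by ring
  rw [e2] at h4 ⊢
  push_cast at h h4
  nlinarith [h, h4]

/-- Absorbs the remainder into a shift of `B`, so that a bound of the form `B ^ i` is reproduced by
each added summand. For `i = 0` it is an equality, which fixes the factor 2. -/
theorem pow_add_mul_le_pow_add {B t c : ℝ} (hB : 0 ≤ B) (ht : 0 ≤ t) (hc : 1 ≤ c) (i : ℕ) :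
    B ^ (i + 1) + c * (B ^ i * t + t ^ (i + 1)) ≤ (B + 2 * c * t) ^ (i + 1) := by
  have hy : 0 ≤ 2 * c * t := by positivity
  rcases Nat.eq_zero_or_pos i with rfl | hi
  · simp; linarith
  · have h1 : B ^ i + (2 * c * t) ^ i ≤ (B + 2 * c * t) ^ i :=
      pow_add_pow_le hB hy (by omega)
    have h2 : t ^ i ≤ (2 * c * t) ^ i := by
      gcongr; nlinarith
    have h3 : (B + 2 * c * t) * (B ^ i + t ^ i) ≤ (B + 2 * c * t) ^ (i + 1) := by
      rw [pow_succ']; gcongr; linarith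
    refine le_trans ?_ h3
    have := mul_nonneg (mul_nonneg (by positivity : 0 ≤ c) ht) (pow_nonneg hB i)
    have := mul_nonneg (mul_nonneg (by positivity : 0 ≤ c) ht) (pow_nonneg ht i)
    have := mul_nonneg hB (pow_nonneg ht i)
    rw [pow_succ, pow_succ]
    nlinarith

section
variable {Ω : Type*} [MeasurableSpace Ω] {P : Measure Ω} [IsProbabilityMeasure P]

theorem MeasureTheory.MemLp.integrable_pow_of_le {g : Ω → ℝ} {p i : ℕ}
    (hg : MemLp g p P) (hi : i ≤ p) : Integrable (fun ω => g ω ^ i) P := by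
  have h : MemLp g i P := hg.mono_exponent (by exact_mod_cast hi)
  have := h.integrable_norm_pow'
  refine (integrable_norm_iff (h.aestronglyMeasurable.pow i)).1 ?_
  simpa using this

theorem integral_add_pow_even_le {q : ℕ} {U V : Ω → ℝ}
    (hU : MemLp U (2 * q : ℕ) P) (hV : MemLp V (2 * q : ℕ) P) (hUV : IndepFun U V P)
    (hV0 : ∫ ω, V ω ∂P = 0) {B t : ℝ} (hB : 0 ≤ B) (ht : 0 ≤ t)
    (hUB : ∀ i ≤ q, ∫ ω, U ω ^ (2 * i) ∂P ≤ B ^ i)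
    (hVt : ∀ i ≤ q, ∫ ω, V ω ^ (2 * i) ∂P ≤ t ^ i) :
    ∀ i ≤ q, ∫ ω, (U ω + V ω) ^ (2 * i) ∂P ≤ (B + 2 * ((2 * q) ^ 2 * 4 ^ q) * t) ^ i := by
  intro i hi
  rcases i with _ | i
  · simp
  set c : ℝ := (2 * q) ^ 2 * 4 ^ q with hcdef
  have hc : 1 ≤ c := by
    have : (1 : ℝ) ≤ q := by exact_mod_cast (by omega : 1 ≤ q)
    have h1 : (1 : ℝ) ≤ (2 * q) ^ 2 := by nlinarith
    have h2 : (1 : ℝ) ≤ 4 ^ q := one_le_pow₀ (by norm_num)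
    nlinarith
  have ind : ∀ m n : ℕ, IndepFun (fun ω => U ω ^ m) (fun ω => V ω ^ n) P := fun m n =>
    hUV.comp (measurable_id.pow_const m) (measurable_id.pow_const n)
  have int : ∀ m n : ℕ, m ≤ 2 * q → n ≤ 2 * q →
      Integrable (fun ω => U ω ^ m * V ω ^ n) P := fun m n hm hn =>
    (ind m n).integrable_mul (hU.integrable_pow_of_le hm) (hV.integrable_pow_of_le hn)
  have intmul : ∀ m n : ℕ, ∫ ω, U ω ^ m * V ω ^ n ∂P = (∫ ω, U ω ^ m ∂P) * ∫ ω, V ω ^ n ∂P :=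
    fun m n => (ind m n).integral_fun_mul_eq_mul_integral
      (hU.aestronglyMeasurable.pow m) (hV.aestronglyMeasurable.pow n)
  have I1 : Integrable (fun ω => U ω ^ (2 * (i + 1))) P := hU.integrable_pow_of_le (by omega)
  have I2 : Integrable (fun ω => (2 * (i : ℝ) + 2) * (U ω ^ (2 * i + 1) * V ω)) P := by
    have := int (2 * i + 1) 1 (by omega) (by omega)
    simp only [pow_one] at this
    exact this.const_mul _
  have I3 : Integrable (fun ω => U ω ^ (2 * i) * V ω ^ 2) P := int _ _ (by omega) (by omega)
  have I4 : Integrable (fun ω => V ω ^ (2 * (i + 1))) P := hV.integrable_pow_of_le (by omega)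
  have z : ∫ ω, (2 * (i : ℝ) + 2) * (U ω ^ (2 * i + 1) * V ω) ∂P = 0 := by
    rw [integral_const_mul]
    have := intmul (2 * i + 1) 1
    simp only [pow_one] at this
    rw [this, hV0]; simp
  calc ∫ ω, (U ω + V ω) ^ (2 * (i + 1)) ∂P
      ≤ ∫ ω, (U ω ^ (2 * (i + 1)) + (2 * i + 2) * (U ω ^ (2 * i + 1) * V ω)
        + c * (U ω ^ (2 * i) * V ω ^ 2 + V ω ^ (2 * (i + 1)))) ∂P := by
        refine integral_mono ((hU.add hV).integrable_pow_of_le (by omega))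
          ((I1.add I2).add ((I3.add I4).const_mul c)) fun ω => ?_
        exact add_pow_even_le hi _ _
    _ = ∫ ω, U ω ^ (2 * (i + 1)) ∂P
        + c * ((∫ ω, U ω ^ (2 * i) ∂P) * ∫ ω, V ω ^ (2 * 1) ∂P + ∫ ω, V ω ^ (2 * (i + 1)) ∂P) := by
        have I12 : Integrable (fun ω => U ω ^ (2 * (i + 1))
          + (2 * (i : ℝ) + 2) * (U ω ^ (2 * i + 1) * V ω)) P := I1.add I2
        have I34 : Integrable (fun ω => c * (U ω ^ (2 * i) * V ω ^ 2 + V ω ^ (2 * (i + 1)))) P :=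
          (I3.add I4).const_mul c
        rw [integral_add I12 I34, integral_add I1 I2, z, integral_const_mul, integral_add I3 I4,
          intmul]
        ring
    _ ≤ B ^ (i + 1) + c * (B ^ i * t ^ 1 + t ^ (i + 1)) := by
        have := hUB (i + 1) hi
        have := hUB i (by omega)
        have := hVt 1 (by omega)
        have := hVt (i + 1) hi
        have n2 : 0 ≤ ∫ ω, V ω ^ (2 * 1) ∂P :=
          integral_nonneg fun ω => (even_two_mul 1).pow_nonneg _
        gcongr
    _ ≤ _ := by rw [pow_one]; exact pow_add_mul_le_pow_add hB ht hc i

/-- Rosenthal-type inequality: independence gives the order `(∑ t) ^ i` instead of `(∑ √t) ^ (2i)`.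
All `i ≤ q` are carried together, since adding one summand uses lower moments of the partial sum. -/
theorem integral_sum_pow_even_le {q : ℕ} {V : ℕ → Ω → ℝ} (hV : ∀ n, MemLp (V n) (2 * q : ℕ) P)
    (hind : ∀ n, IndepFun (fun ω => ∑ j ∈ Finset.range n, V j ω) (V n) P)
    (hV0 : ∀ n, ∫ ω, V n ω ∂P = 0) {t : ℕ → ℝ} (ht : ∀ n, 0 ≤ t n)
    (hVt : ∀ n, ∀ i ≤ q, ∫ ω, V n ω ^ (2 * i) ∂P ≤ t n ^ i) (n : ℕ) :
    ∀ i ≤ q, ∫ ω, (∑ j ∈ Finset.range n, V j ω) ^ (2 * i) ∂P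
      ≤ (2 * ((2 * q) ^ 2 * 4 ^ q) * ∑ j ∈ Finset.range n, t j) ^ i := by
  induction n with
  | zero =>
    intro i _
    rcases i with _ | i <;> simp
  | succ n ih =>
    intro i hi
    simp only [Finset.sum_range_succ]
    have := integral_add_pow_even_le (q := q) (U := fun ω => ∑ j ∈ Finset.range n, V j ω)
      (memLp_finsetSum _ fun j _ => hV j) (hV n) (hind n) (hV0 n)
      (mul_nonneg (by positivity) (Finset.sum_nonneg fun j _ => ht j)) (ht n) ih (hVt n) i hi
    rwa [← mul_add] at this
end

/-! ### Geometric blocks and moments of weighted block sums. -/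

/-- The σ-algebra generated by the `X j` with `j ∈ s`. -/
abbrev indexSigma {Ω : Type*} (X : ℕ → Ω → ℝ) (s : Set ℕ) : MeasurableSpace Ω :=
  ⨆ j ∈ s, (inferInstance : MeasurableSpace ℝ).comap (X j)

/-- The left end of the block preceding the block `[R ^ j, R ^ (j + 1))`. -/
def blockStart (R j : ℕ) : ℕ := if j = 0 then 0 else R ^ (j - 1)

section
variable {Ω : Type*} {X : ℕ → Ω → ℝ}

theorem indexSigma_mono {s t : Set ℕ} (h : s ⊆ t) : indexSigma X s ≤ indexSigma X t :=
  biSup_mono h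

theorem measurable_indexSigma {s : Set ℕ} {j : ℕ} (hj : j ∈ s) :
    Measurable[indexSigma X s] (X j) := by
  rw [measurable_iff_comap_le]
  exact le_biSup (fun j => (inferInstance : MeasurableSpace ℝ).comap (X j)) hj

variable [MeasurableSpace Ω] {P : Measure Ω}

theorem indepFun_of_measurable_indexSigma (hX : ∀ i, Measurable (X i)) (hind : iIndepFun X P)
    {s t : Set ℕ} (hst : Disjoint s t) {U V : Ω → ℝ} (hU : Measurable[indexSigma X s] U)
    (hV : Measurable[indexSigma X t] V) : IndepFun U V P := by
  have h : Indep (indexSigma X s) (indexSigma X t) P :=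
    indep_iSup_of_disjoint (fun i => (hX i).comap_le) hind hst
  rw [IndepFun_iff_Indep]
  exact indep_of_indep_of_le_left (indep_of_indep_of_le_right h hV.comap_le) hU.comap_le

/-- Jensen's inequality for the weights `w k / ∑ w`, with denominators cleared so that total weight
zero is allowed. -/
theorem sum_mul_pow_le {ι : Type*} (s : Finset ι) {w y : ι → ℝ} (hw : ∀ k ∈ s, 0 ≤ w k) {p : ℕ}
    (hp : Even p) (hp0 : p ≠ 0) :
    (∑ k ∈ s, w k * y k) ^ p ≤ (∑ k ∈ s, w k) ^ (p - 1) * ∑ k ∈ s, w k * y k ^ p := by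
  obtain ⟨p, rfl⟩ := Nat.exists_eq_succ_of_ne_zero hp0
  rcases (Finset.sum_nonneg hw).eq_or_lt with h0 | h0
  · have hz : ∀ k ∈ s, w k = 0 := (Finset.sum_eq_zero_iff_of_nonneg hw).1 h0.symm
    have hz' : ∀ z : ι → ℝ, ∑ k ∈ s, w k * z k = 0 := fun z =>
      Finset.sum_eq_zero fun k hk => by rw [hz k hk, zero_mul]
    rw [hz', hz', mul_zero, zero_pow hp0]
  · set W := ∑ k ∈ s, w k
    have h := Real.pow_arith_mean_le_arith_mean_pow_of_even s (fun k => w k / W) y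
      (fun k hk => div_nonneg (hw k hk) h0.le) (by rw [← Finset.sum_div, div_self h0.ne']) hp
    simp only [div_mul_eq_mul_div, ← Finset.sum_div, div_pow] at h
    rw [div_le_div_iff₀ (by positivity) h0] at h
    simp only [Nat.succ_eq_add_one, Nat.add_sub_cancel] at h ⊢
    rw [pow_succ W p] at h
    refine le_of_mul_le_mul_right (h.trans_eq ?_) h0
    rw [← mul_assoc, mul_comm _ (W ^ p)]

variable [IsProbabilityMeasure P]

theorem integral_sum_mul_pow_le {ι : Type*} (s : Finset ι) {w : ι → ℝ} (hw : ∀ k ∈ s, 0 ≤ w k)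
    {p n : ℕ} (hp : Even p) (hp0 : p ≠ 0) (hpn : p ≤ n) {Y : ι → Ω → ℝ}
    (hY : ∀ k ∈ s, MemLp (Y k) n P) {M : ℝ} (hM : ∀ k ∈ s, ∫ ω, Y k ω ^ p ∂P ≤ M) :
    ∫ ω, (∑ k ∈ s, w k * Y k ω) ^ p ∂P ≤ (∑ k ∈ s, w k) ^ p * M := by
  have hint : Integrable (fun ω => ∑ k ∈ s, w k * Y k ω ^ p) P :=
    integrable_finsetSum _ fun k hk => ((hY k hk).integrable_pow_of_le hpn).const_mul _
  calc ∫ ω, (∑ k ∈ s, w k * Y k ω) ^ p ∂P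
      ≤ ∫ ω, (∑ k ∈ s, w k) ^ (p - 1) * ∑ k ∈ s, w k * Y k ω ^ p ∂P := by
        refine integral_mono ?_ (hint.const_mul _) fun ω => sum_mul_pow_le s hw hp hp0
        exact (memLp_finsetSum _ fun k hk => (hY k hk).const_mul (w k)).integrable_pow_of_le hpn
    _ = (∑ k ∈ s, w k) ^ (p - 1) * ∑ k ∈ s, w k * ∫ ω, Y k ω ^ p ∂P := by
        rw [integral_const_mul, integral_finsetSum _ fun k hk =>
          ((hY k hk).integrable_pow_of_le hpn).const_mul _]
        simp only [integral_const_mul]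
    _ ≤ (∑ k ∈ s, w k) ^ (p - 1) * ∑ k ∈ s, w k * M := by
        have := Finset.sum_nonneg hw
        gcongr with k hk
        · exact hw k hk
        · exact hM k hk
    _ = _ := by
        rw [← Finset.sum_mul, ← mul_assoc, pow_sub_one_mul hp0]

theorem integral_add_pow_le {p : ℕ} (hp : Even p) {U V : Ω → ℝ} (hU : MemLp U p P)
    (hV : MemLp V p P) : ∫ ω, (U ω + V ω) ^ p ∂P
      ≤ 2 ^ p * (∫ ω, U ω ^ p ∂P + ∫ ω, V ω ^ p ∂P) := by
  have hU' := hU.integrable_pow_of_le le_rfl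
  have hV' := hV.integrable_pow_of_le le_rfl
  rw [← integral_add hU' hV', ← integral_const_mul]
  refine integral_mono ((hU.add hV).integrable_pow_of_le le_rfl)
    ((hU'.add hV').const_mul _) fun ω => ?_
  refine hp.add_pow_le.trans ?_
  have : (2 : ℝ) ^ (p - 1) ≤ 2 ^ p := pow_le_pow_right₀ (by norm_num) (by omega)
  have := hp.pow_nonneg (U ω)
  have := hp.pow_nonneg (V ω)
  gcongr

theorem sum_range_two_mul (g : ℕ → ℝ) (n : ℕ) : ∑ j ∈ Finset.range (2 * n), g j
    = ∑ i ∈ Finset.range n, g (2 * i + 0) + ∑ i ∈ Finset.range n, g (2 * i + 1) := by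
  induction n with
  | zero => simp
  | succ n ih =>
    rw [show 2 * (n + 1) = 2 * n + 1 + 1 by ring, Finset.sum_range_succ, Finset.sum_range_succ, ih,
      Finset.sum_range_succ, Finset.sum_range_succ, add_zero (2 * n)]
    linarith

/-- The `j`-th block sum involves only the variables with index in `[R^(j-1), R^(j+1))`, so blocks
of equal parity are independent. Even and odd blocks are treated separately and recombined at the
cost of a constant. -/
theorem integral_sum_blocks_pow_le (hX : ∀ i, Measurable (X i)) (hind : iIndepFun X P)
    {R : ℕ} (hR : 2 ≤ R) {q : ℕ} (hq : 1 ≤ q) {d : ℕ → ℝ}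
    (hd : ∀ k, 1 ≤ k → 0 ≤ d k) (N : ℕ)
    {η : ℕ → Ω → ℝ}
    (hmeas : ∀ k, Measurable[indexSigma X (Set.Ico (blockStart R (Nat.log R k)) k)] (η k))
    (hLp : ∀ k, MemLp (η k) (2 * q : ℕ) P) (h0 : ∀ k, ∫ ω, η k ω ∂P = 0)
    {M w : ℝ} (hM1 : 1 ≤ M) (hM : ∀ k, 1 ≤ k → ∀ i ≤ q, ∫ ω, η k ω ^ (2 * i) ∂P ≤ M)
    (hw : ∀ j, ∑ k ∈ Finset.Icc 1 N with Nat.log R k = j, d k ≤ w) :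
    ∫ ω, (∑ k ∈ Finset.Icc 1 N, d k * η k ω) ^ (2 * q) ∂P
      ≤ 4 ^ q * (2 * (2 * ((2 * q) ^ 2 * 4 ^ q) * (M * w * ∑ k ∈ Finset.Icc 1 N, d k)) ^ q) := by
  set B : ℕ → Finset ℕ := fun j => {k ∈ Finset.Icc 1 N | Nat.log R k = j} with hB
  set W : ℕ → ℝ := fun j => ∑ k ∈ B j, d k with hWdef
  set V : ℕ → Ω → ℝ := fun j ω => ∑ k ∈ B j, d k * η k ω with hVdef
  have hdB : ∀ j, ∀ k ∈ B j, 0 ≤ d k := fun j k hk =>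
    hd k (Finset.mem_Icc.1 (Finset.mem_filter.1 hk).1).1
  have hW0 : ∀ j, 0 ≤ W j := fun j => Finset.sum_nonneg (hdB j)
  have hw0 : 0 ≤ w := (hW0 0).trans (hw 0)
  have hVLp : ∀ j, MemLp (V j) (2 * q : ℕ) P := fun j =>
    memLp_finsetSum _ fun k _ => (hLp k).const_mul (d k)
  -- More blocks than needed, but an even number of them, ready for the parity split.
  have hmaps : ∀ k ∈ Finset.Icc 1 N, Nat.log R k ∈ Finset.range (2 * (N + 1)) := by
    intro k hk
    have := Nat.log_le_self R k
    have := (Finset.mem_Icc.1 hk).2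
    simp only [Finset.mem_range]; omega
  have hsumV : ∀ ω, ∑ k ∈ Finset.Icc 1 N, d k * η k ω
      = ∑ j ∈ Finset.range (2 * (N + 1)), V j ω := fun ω =>
    (Finset.sum_fiberwise_of_maps_to hmaps _).symm
  have hsumW : ∑ k ∈ Finset.Icc 1 N, d k = ∑ j ∈ Finset.range (2 * (N + 1)), W j :=
    (Finset.sum_fiberwise_of_maps_to hmaps _).symm
  have hR0 : 0 < R := by omega
  have hVmeas : ∀ j, Measurable[indexSigma X (Set.Ico (blockStart R j) (R ^ (j + 1)))] (V j) := by
    intro j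
    refine Finset.measurable_fun_sum _ fun k hk => ?_
    obtain ⟨-, hkj⟩ := Finset.mem_filter.1 hk
    refine Measurable.const_mul ((hmeas k).mono (indexSigma_mono ?_) le_rfl) _
    rw [hkj]
    refine Set.Ico_subset_Ico_right ?_
    rw [← hkj]
    exact (Nat.lt_pow_succ_log_self (by omega) k).le
  have hV0 : ∀ j, ∫ ω, V j ω ∂P = 0 := by
    intro j
    rw [integral_finsetSum _ fun k _ => ?_]
    · exact Finset.sum_eq_zero fun k _ => by rw [integral_const_mul, h0, mul_zero]
    · have := (hLp k).integrable_pow_of_le (i := 1) (by omega)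
      simp only [pow_one] at this
      exact this.const_mul _
  -- Of the two factors `W j` in the second moment, one is bounded by `w`; the other is kept and
  -- sums to the total weight.
  have hVt : ∀ j, ∀ i ≤ q, ∫ ω, V j ω ^ (2 * i) ∂P ≤ (M * w * W j) ^ i := by
    intro j i hi
    rcases Nat.eq_zero_or_pos i with rfl | hi0
    · simp
    calc ∫ ω, V j ω ^ (2 * i) ∂P ≤ W j ^ (2 * i) * M :=
          integral_sum_mul_pow_le _ (hdB j) (even_two_mul i) (by omega)
            (Nat.mul_le_mul_left 2 hi) (fun k _ => hLp k) fun k hk =>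
            hM k (Finset.mem_Icc.1 (Finset.mem_filter.1 hk).1).1 i hi
      _ ≤ W j ^ (2 * i) * M ^ i := by
          have := le_self_pow₀ hM1 hi0.ne'
          have := hW0 j
          gcongr
      _ = (M * W j * W j) ^ i := by rw [pow_mul]; ring
      _ ≤ (M * w * W j) ^ i := by
          have := hW0 j
          have := hw j
          gcongr
  have key : ∀ ε, ∑ i ∈ Finset.range (N + 1), W (2 * i + ε) ≤ ∑ k ∈ Finset.Icc 1 N, d k →
      ∫ ω, (∑ i ∈ Finset.range (N + 1), V (2 * i + ε) ω) ^ (2 * q) ∂P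
        ≤ (2 * ((2 * q) ^ 2 * 4 ^ q) * (M * w * ∑ k ∈ Finset.Icc 1 N, d k)) ^ q := by
    intro ε hε
    refine (integral_sum_pow_even_le (V := fun i => V (2 * i + ε)) (fun i => hVLp _) (fun n => ?_)
      (fun i => hV0 _) (t := fun i => M * w * W (2 * i + ε)) (fun i => ?_) (fun i => hVt _)
      (N + 1) q le_rfl).trans ?_
    -- Earlier blocks of the same parity use indices below `R ^ (2n + ε - 1)`, where the range of
    -- the current block starts.
    · refine indepFun_of_measurable_indexSigma hX hind (s := Set.Iio (blockStart R (2 * n + ε)))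
        (t := Set.Ico (blockStart R (2 * n + ε)) (R ^ (2 * n + ε + 1))) ?_ ?_ (hVmeas _)
      · rw [Set.disjoint_left]
        intro x hx hx'
        exact absurd hx'.1 (not_le.2 hx)
      · refine Finset.measurable_fun_sum _ fun i hi => (hVmeas _).mono (indexSigma_mono ?_) le_rfl
        have hin : i < n := Finset.mem_range.1 hi
        intro x hx
        have : blockStart R (2 * n + ε) = R ^ (2 * n + ε - 1) := by
          rw [blockStart, if_neg (by omega)]
        rw [Set.mem_Iio, this]
        exact hx.2.trans_le (Nat.pow_le_pow_right hR0 (by omega))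
    · have := hW0 (2 * i + ε)
      positivity
    · rw [← Finset.mul_sum]
      have : 0 ≤ ∑ i ∈ Finset.range (N + 1), W (2 * i + ε) := Finset.sum_nonneg fun i _ => hW0 _
      gcongr
  have hWsplit := sum_range_two_mul W (N + 1)
  rw [← hsumW] at hWsplit
  have n0 : 0 ≤ ∑ i ∈ Finset.range (N + 1), W (2 * i + 0) := Finset.sum_nonneg fun i _ => hW0 _
  have n1 : 0 ≤ ∑ i ∈ Finset.range (N + 1), W (2 * i + 1) := Finset.sum_nonneg fun i _ => hW0 _
  have k0 := key 0 (by linarith)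
  have k1 := key 1 (by linarith)
  simp only [hsumV, fun ω => sum_range_two_mul (fun j => V j ω) (N + 1)]
  refine (integral_add_pow_le (even_two_mul q) (memLp_finsetSum _ fun i _ => hVLp _)
    (memLp_finsetSum _ fun i _ => hVLp _)).trans ?_
  rw [pow_mul, show (2 : ℝ) ^ 2 = 4 by norm_num]
  gcongr
  linarith
end

/-! ### Truncation and the moment bound for a fixed block ratio. -/

/-- The normalized sum `S_k / a_k - b_k` with the contribution of the first `t` summands removed:
for `t ≤ k` it depends only on the summands with index in `[t, k)`. -/
noncomputable def truncNormSum {Ω : Type*} (X : ℕ → Ω → ℝ) (a b : ℕ → ℝ) (t k : ℕ) (ω : Ω) : ℝ :=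
  normSum X a b k ω - (if t = 0 then 0 else a t / a k) * normSum X a b t ω

theorem blockStart_le {R : ℕ} (hR : 2 ≤ R) (k : ℕ) : blockStart R (Nat.log R k) ≤ k := by
  unfold blockStart
  split_ifs with h
  · exact Nat.zero_le k
  · have hk : k ≠ 0 := by rintro rfl; simp at h
    exact (Nat.pow_le_pow_right (by omega) (Nat.sub_le _ _)).trans (Nat.pow_log_le_self R hk)

theorem blockStart_div_le {R : ℕ} (hR : 2 ≤ R) {k : ℕ} (hk : 1 ≤ k) :
    (blockStart R (Nat.log R k) : ℝ) / k ≤ (R : ℝ)⁻¹ := by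
  have hk0 : (0 : ℝ) < k := by exact_mod_cast hk
  have hR0 : (0 : ℝ) < R := by exact_mod_cast (by omega : 0 < R)
  unfold blockStart
  split_ifs with h
  · simp
  · rw [div_le_iff₀ hk0, ← div_eq_inv_mul, le_div_iff₀ hR0]
    have h1 : R ^ (Nat.log R k - 1) * R ≤ k := by
      rw [← pow_succ, Nat.sub_add_cancel (by omega)]
      exact Nat.pow_log_le_self R (by omega)
    exact_mod_cast h1

section
variable {Ω : Type*} {X : ℕ → Ω → ℝ} {a b : ℕ → ℝ}

/-- The subtracted multiple of `normSum` at `t` cancels `S_t / a k` and leaves constants. The case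
`t = 0` is separate because `a 0` may vanish; there `S_0 = 0` and nothing is removed. -/
theorem measurable_truncNormSum (ha : ∀ n, 1 ≤ n → 0 < a n) {t k : ℕ} (htk : t ≤ k) :
    Measurable[indexSigma X (Set.Ico t k)] (truncNormSum X a b t k) := by
  have e : truncNormSum X a b t k = fun ω =>
      (∑ j ∈ Finset.Ico t k, X j ω + if t = 0 then 0 else a t * b t) / a k - b k := by
    ext ω
    rw [Finset.sum_Ico_eq_sub _ htk]
    unfold truncNormSum normSum partialSum
    split_ifs with h
    · simp [h]
    · have := (ha t (by omega)).ne'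
      field_simp
      ring
  rw [e]
  exact ((Finset.measurable_fun_sum _ fun j hj =>
    measurable_indexSigma (Finset.mem_Ico.1 hj)).add_const _).div_const _ |>.sub_const _

variable [MeasurableSpace Ω] {P : Measure Ω}

theorem measurable_normSum (hX : ∀ i, Measurable (X i)) (n : ℕ) : Measurable (normSum X a b n) :=
  ((Finset.measurable_fun_sum _ fun j _ => hX j).div_const _).sub_const _

variable [IsProbabilityMeasure P]

theorem LipschitzWith.memLp_comp {f : ℝ → ℝ} {K : ℝ≥0} (hf : LipschitzWith K f) {p : ℝ≥0∞}
    {Y : Ω → ℝ} (hY : MemLp Y p P) : MemLp (fun ω => f (Y ω)) p P := by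
  have h := (hf.sub (LipschitzWith.const (f 0))).comp_memLp (by simp) hY
  refine (h.add (memLp_const (f 0))).ae_eq (ae_of_all _ fun ω => ?_)
  simp

theorem integral_pow_le_integral_pow {p : ℕ} (hp : Even p) {h : Ω → ℝ} (hh : MemLp h p P) :
    (∫ ω, h ω ∂P) ^ p ≤ ∫ ω, h ω ^ p ∂P := by
  rcases Nat.eq_zero_or_pos p with rfl | hp0
  · simp
  refine (hp.convexOn_pow (𝕜 := ℝ)).map_integral_le (by fun_prop) isClosed_univ (by simp) ?_
    (hh.integrable_pow_of_le le_rfl)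
  simpa using hh.integrable_pow_of_le (i := 1) hp0

theorem integral_sub_integral_pow_le {p : ℕ} (hp : Even p) {h : Ω → ℝ} (hh : MemLp h p P) :
    ∫ ω, (h ω - ∫ ω', h ω' ∂P) ^ p ∂P ≤ 2 ^ p * (2 * ∫ ω, h ω ^ p ∂P) := by
  have h1 := integral_add_pow_le hp hh (memLp_const (-∫ ω', h ω' ∂P))
  simp only [← sub_eq_add_neg, hp.neg_pow, integral_const, probReal_univ, one_smul] at h1
  refine h1.trans ?_
  have := integral_pow_le_integral_pow hp hh
  gcongr
  linarith

theorem integral_pow_le_one_add {q i : ℕ} (hi : i ≤ q) {h : Ω → ℝ} (hh : MemLp h (2 * q : ℕ) P) :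
    ∫ ω, h ω ^ (2 * i) ∂P ≤ 1 + ∫ ω, h ω ^ (2 * q) ∂P := by
  have hq := hh.integrable_pow_of_le (i := 2 * q) le_rfl
  have e : ∫ ω, (1 + h ω ^ (2 * q)) ∂P = 1 + ∫ ω, h ω ^ (2 * q) ∂P := by
    rw [integral_add (integrable_const _) hq]; simp
  rw [← e]
  refine integral_mono (hh.integrable_pow_of_le (by omega)) ((integrable_const 1).add hq)
    fun ω => ?_
  simp only [pow_mul]
  have h0 := sq_nonneg (h ω)
  rcases le_total (h ω ^ 2) 1 with h1 | h1
  · have := pow_le_one₀ (n := i) h0 h1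
    have := pow_nonneg h0 q
    linarith
  · have := pow_le_pow_right₀ h1 hi
    linarith

/-- The first term is the truncation error, the second the block estimate. The constant does not
depend on `R`, `N`, `w`, because `R` will be chosen as a function of `N`. -/
theorem integral_weighted_sum_pow_le (hX : ∀ i, Measurable (X i)) (hind : iIndepFun X P)
    (ha : ∀ n, 1 ≤ n → 0 < a n) {C β : ℝ} (hC : 0 < C) (hβ : 0 < β)
    (hab : ∀ k l : ℕ, 1 ≤ k → k ≤ l → a k / a l ≤ C * ((k : ℝ) / (l : ℝ)) ^ β)
    {q : ℕ} (hq : 1 ≤ q) (hLp : ∀ k, MemLp (normSum X a b k) (2 * q : ℕ) P) {M : ℝ}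
    (hM : ∀ k, 1 ≤ k → ∫ ω, normSum X a b k ω ^ (2 * q) ∂P ≤ M)
    {d : ℕ → ℝ} (hd : ∀ k, 1 ≤ k → 0 < d k) {f : ℝ → ℝ} {K : ℝ≥0} (hf : LipschitzWith K f) :
    ∃ A : ℝ, 0 ≤ A ∧ ∀ R : ℕ, 2 ≤ R → ∀ N : ℕ, ∀ w : ℝ,
      (∀ j, ∑ k ∈ Finset.Icc 1 N with Nat.log R k = j, d k ≤ w) →
      ∫ ω, (∑ k ∈ Finset.Icc 1 N,
        d k * (f (normSum X a b k ω) - ∫ ω', f (normSum X a b k ω') ∂P)) ^ (2 * q) ∂P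
        ≤ A * ((totalWeight d N * (R : ℝ)⁻¹ ^ β) ^ (2 * q) + (w * totalWeight d N) ^ q) := by
  have hM0 : 0 ≤ M := (integral_nonneg fun ω => (even_two_mul q).pow_nonneg _).trans (hM 1 le_rfl)
  -- `E` is the constant in the truncation error, `F` bounds the `2q`-th moment of `f (Z k)`, and
  -- `M₁` bounds the even moments of the centred truncated variables.
  set E : ℝ := (K * C) ^ (2 * q) * M with hE
  have hE0 : 0 ≤ E := by positivity
  set F : ℝ := 2 ^ (2 * q) * (f 0 ^ (2 * q) + (K : ℝ) ^ (2 * q) * M) with hF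
  have hf0 : 0 ≤ f 0 ^ (2 * q) := (even_two_mul q).pow_nonneg _
  have hF0 : 0 ≤ F := by positivity
  set M₁ : ℝ := 1 + 2 ^ (2 * q) * (2 * (2 ^ (2 * q) * (F + E))) with hM₁
  have hM₁1 : 1 ≤ M₁ := by
    rw [hM₁]; exact le_add_of_nonneg_right (by positivity)
  set A₁ : ℝ := 2 ^ (2 * q) * (2 * E) with hA₁
  set A₂ : ℝ := 4 ^ q * (2 * (2 * ((2 * q) ^ 2 * 4 ^ q) * M₁) ^ q) with hA₂
  have hA₁0 : 0 ≤ A₁ := by positivity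
  have hA₂0 : 0 ≤ A₂ := by positivity
  refine ⟨2 ^ (2 * q) * (A₁ + A₂), by positivity, fun R hR N w hw => ?_⟩
  set Z := normSum X a b with hZ
  set T : ℕ → ℕ := fun k => blockStart R (Nat.log R k) with hT
  set Y : ℕ → Ω → ℝ := fun k => truncNormSum X a b (T k) k with hYdef
  have hYLp : ∀ k, MemLp (Y k) (2 * q : ℕ) P := fun k => (hLp k).sub ((hLp _).const_mul _)
  have hfZ : ∀ k, MemLp (fun ω => f (Z k ω)) (2 * q : ℕ) P := fun k => hf.memLp_comp (hLp k)
  have hfY : ∀ k, MemLp (fun ω => f (Y k ω)) (2 * q : ℕ) P := fun k => hf.memLp_comp (hYLp k)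
  have hR0 : (0 : ℝ) < R := by exact_mod_cast (by omega : 0 < R)
  have hRi : (0 : ℝ) ≤ (R : ℝ)⁻¹ ^ β := by positivity
  have hRi1 : (R : ℝ)⁻¹ ^ β ≤ 1 :=
    Real.rpow_le_one (by positivity) (inv_le_one_of_one_le₀ (by exact_mod_cast (by omega : 1 ≤ R)))
      hβ.le
  -- replacing `Z k` by `Y k`
  have hdiff : ∀ k, 1 ≤ k → ∫ ω, (f (Z k ω) - f (Y k ω)) ^ (2 * q) ∂P
      ≤ E * ((R : ℝ)⁻¹ ^ β) ^ (2 * q) := by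
    intro k hk
    have hpt : ∀ ω, |f (Z k ω) - f (Y k ω)| ≤
        K * C * (R : ℝ)⁻¹ ^ β * (if T k = 0 then 0 else |Z (T k) ω|) := by
      intro ω
      have h1 := hf.dist_le_mul (Z k ω) (Y k ω)
      rw [Real.dist_eq, Real.dist_eq] at h1
      refine h1.trans ?_
      have e : Z k ω - Y k ω = (if T k = 0 then 0 else a (T k) / a k) * Z (T k) ω := by
        simp only [hYdef, truncNormSum, hZ]; ring
      rw [e]
      split_ifs with h
      · simp
      · have hT1 : 1 ≤ T k := Nat.one_le_iff_ne_zero.2 h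
        have hpos : 0 ≤ a (T k) / a k := (div_pos (ha _ hT1) (ha k hk)).le
        rw [abs_mul, abs_of_nonneg hpos, mul_assoc (K : ℝ), mul_assoc (K : ℝ)]
        have h2 := hab (T k) k hT1 (blockStart_le hR k)
        have h3 : ((T k : ℝ) / k) ^ β ≤ (R : ℝ)⁻¹ ^ β :=
          Real.rpow_le_rpow (by positivity) (blockStart_div_le hR hk) hβ.le
        gcongr
        exact h2.trans (by gcongr)
    rcases eq_or_ne (T k) 0 with h | h
    · have : ∀ ω, f (Z k ω) - f (Y k ω) = 0 := fun ω => by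
        have := hpt ω
        rw [if_pos h, mul_zero] at this
        exact abs_nonpos_iff.1 this
      simp only [this]
      rw [zero_pow (by omega), integral_zero]
      positivity
    · simp only [if_neg h] at hpt
      calc _ ≤ ∫ ω, (K * C * (R : ℝ)⁻¹ ^ β) ^ (2 * q) * Z (T k) ω ^ (2 * q) ∂P := by
            refine integral_mono (((hfZ k).sub (hfY k)).integrable_pow_of_le le_rfl)
              (((hLp (T k)).integrable_pow_of_le le_rfl).const_mul _) fun ω => ?_
            have h4 := pow_le_pow_left₀ (abs_nonneg _) (hpt ω) (2 * q)
            rwa [mul_pow, Even.pow_abs (even_two_mul q), Even.pow_abs (even_two_mul q)] at h4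
        _ = (K * C * (R : ℝ)⁻¹ ^ β) ^ (2 * q) * ∫ ω, Z (T k) ω ^ (2 * q) ∂P :=
            integral_const_mul _ _
        _ ≤ (K * C * (R : ℝ)⁻¹ ^ β) ^ (2 * q) * M := by
            have := hM (T k) (Nat.one_le_iff_ne_zero.2 h)
            gcongr
        _ = _ := by rw [hE, mul_pow]; ring
  have hfZM : ∀ k, 1 ≤ k → ∫ ω, f (Z k ω) ^ (2 * q) ∂P ≤ F := by
    intro k hk
    have e : ∀ ω, f (Z k ω) ^ (2 * q) = (f 0 + (f (Z k ω) - f 0)) ^ (2 * q) := fun ω => by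
      congr 1; ring
    rw [integral_congr_ae (ae_of_all _ e)]
    refine (integral_add_pow_le (even_two_mul q) (memLp_const _)
      ((hfZ k).sub (memLp_const _))).trans ?_
    rw [hF]
    gcongr
    · simp
    · calc _ ≤ ∫ ω, (K : ℝ) ^ (2 * q) * Z k ω ^ (2 * q) ∂P := by
            refine integral_mono (((hfZ k).sub (memLp_const _)).integrable_pow_of_le le_rfl)
              (((hLp k).integrable_pow_of_le le_rfl).const_mul _) fun ω => ?_
            have h1 := hf.dist_le_mul (Z k ω) 0
            rw [Real.dist_eq, Real.dist_eq, sub_zero] at h1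
            have h4 := pow_le_pow_left₀ (abs_nonneg _) h1 (2 * q)
            rwa [mul_pow, Even.pow_abs (even_two_mul q), Even.pow_abs (even_two_mul q)] at h4
        _ ≤ _ := by
            rw [integral_const_mul]
            have := hM k hk
            gcongr
  have hfYM : ∀ k, 1 ≤ k → ∫ ω, f (Y k ω) ^ (2 * q) ∂P ≤ 2 ^ (2 * q) * (F + E) := by
    intro k hk
    have e : ∀ ω, f (Y k ω) ^ (2 * q) = (f (Z k ω) + -(f (Z k ω) - f (Y k ω))) ^ (2 * q) :=
      fun ω => by congr 1; ring
    rw [integral_congr_ae (ae_of_all _ e)]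
    refine (integral_add_pow_le (even_two_mul q) (hfZ k) ((hfZ k).sub (hfY k)).neg).trans ?_
    simp only [Pi.neg_apply, Pi.sub_apply, (even_two_mul q).neg_pow]
    have h1 := hdiff k hk
    have h2 : E * ((R : ℝ)⁻¹ ^ β) ^ (2 * q) ≤ E :=
      mul_le_of_le_one_right hE0 (pow_le_one₀ hRi hRi1)
    gcongr
    · exact hfZM k hk
    · exact h1.trans h2
  set ξ : ℕ → Ω → ℝ := fun k ω => f (Z k ω) - ∫ ω', f (Z k ω') ∂P with hξ
  set η : ℕ → Ω → ℝ := fun k ω => f (Y k ω) - ∫ ω', f (Y k ω') ∂P with hη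
  have hηLp : ∀ k, MemLp (η k) (2 * q : ℕ) P := fun k => (hfY k).sub (memLp_const _)
  have hξLp : ∀ k, MemLp (ξ k) (2 * q : ℕ) P := fun k => (hfZ k).sub (memLp_const _)
  have hintegrable : ∀ {h : Ω → ℝ}, MemLp h (2 * q : ℕ) P → Integrable h P := fun h => by
    simpa using h.integrable_pow_of_le (i := 1) (by omega)
  have hmain := integral_sum_blocks_pow_le hX hind hR hq (fun k hk => (hd k hk).le) N (η := η)
    (fun k => (hf.continuous.measurable.comp
      (measurable_truncNormSum ha (blockStart_le hR k))).sub_const _) hηLp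
    (fun k => by
      rw [hη, integral_sub (hintegrable (hfY k)) (integrable_const _)]; simp)
    hM₁1 (fun k hk i hi => by
      refine (integral_pow_le_one_add hi (hηLp k)).trans ?_
      rw [hM₁]
      gcongr
      refine (integral_sub_integral_pow_le (even_two_mul q) (hfY k)).trans ?_
      gcongr
      exact hfYM k hk) hw
  -- No independence is used for the truncation error: convexity suffices, as each term already
  -- carries the factor `R ^ (-β)`.
  have herr : ∫ ω, (∑ k ∈ Finset.Icc 1 N, d k * (ξ k ω - η k ω)) ^ (2 * q) ∂P
      ≤ totalWeight d N ^ (2 * q) * (2 ^ (2 * q) * (2 * (E * ((R : ℝ)⁻¹ ^ β) ^ (2 * q)))) := by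
    refine integral_sum_mul_pow_le _ (fun k hk => (hd k (Finset.mem_Icc.1 hk).1).le)
      (even_two_mul q) (by omega) le_rfl (fun k _ => (hξLp k).sub (hηLp k)) fun k hk => ?_
    have e : ∀ ω, (ξ k - η k) ω ^ (2 * q)
        = ((f (Z k ω) - f (Y k ω)) - ∫ ω', (f (Z k ω') - f (Y k ω')) ∂P) ^ (2 * q) := by
      intro ω
      rw [integral_sub (hintegrable (hfZ k)) (hintegrable (hfY k))]
      simp only [hξ, hη, Pi.sub_apply]
      congr 1; ring
    rw [integral_congr_ae (ae_of_all _ e)]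
    refine (integral_sub_integral_pow_le (even_two_mul q) ((hfZ k).sub (hfY k))).trans ?_
    gcongr
    exact hdiff k (Finset.mem_Icc.1 hk).1
  have hsplit : ∀ ω, ∑ k ∈ Finset.Icc 1 N, d k * ξ k ω
      = ∑ k ∈ Finset.Icc 1 N, d k * (ξ k ω - η k ω) + ∑ k ∈ Finset.Icc 1 N, d k * η k ω := by
    intro ω
    rw [← Finset.sum_add_distrib]
    exact Finset.sum_congr rfl fun k _ => by ring
  change ∫ ω, (∑ k ∈ Finset.Icc 1 N, d k * ξ k ω) ^ (2 * q) ∂P ≤ _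
  simp only [hsplit]
  refine (integral_add_pow_le (even_two_mul q)
    (U := fun ω => ∑ k ∈ Finset.Icc 1 N, d k * (ξ k ω - η k ω))
    (V := fun ω => ∑ k ∈ Finset.Icc 1 N, d k * η k ω)
    (memLp_finsetSum _ fun k _ => ((hξLp k).sub (hηLp k)).const_mul (d k))
    (memLp_finsetSum _ fun k _ => (hηLp k).const_mul (d k))).trans ?_
  rw [mul_assoc]
  have hw0 : 0 ≤ w := by
    refine le_trans (Finset.sum_nonneg fun k hk => ?_) (hw 0)
    exact (hd k (Finset.mem_Icc.1 (Finset.mem_filter.1 hk).1).1).le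
  have hD0 : 0 ≤ totalWeight d N :=
    Finset.sum_nonneg fun k hk => (hd k (Finset.mem_Icc.1 hk).1).le
  have e1 : totalWeight d N ^ (2 * q) * (2 ^ (2 * q) * (2 * (E * ((R : ℝ)⁻¹ ^ β) ^ (2 * q))))
      = A₁ * (totalWeight d N * (R : ℝ)⁻¹ ^ β) ^ (2 * q) := by
    rw [hA₁, mul_pow]; ring
  have e2 : 4 ^ q * (2 * (2 * ((2 * q) ^ 2 * 4 ^ q) * (M₁ * w * ∑ k ∈ Finset.Icc 1 N, d k)) ^ q)
      = A₂ * (w * totalWeight d N) ^ q := by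
    rw [hA₂, totalWeight, ← mul_assoc (2 * ((2 * (q : ℝ)) ^ 2 * 4 ^ q)),
      ← mul_assoc (2 * ((2 * (q : ℝ)) ^ 2 * 4 ^ q)), mul_assoc _ w, mul_pow _ (w * _)]
    ring
  rw [e1] at herr
  rw [e2] at hmain
  have p1 : 0 ≤ (totalWeight d N * (R : ℝ)⁻¹ ^ β) ^ (2 * q) := by positivity
  have p2 : 0 ≤ (w * totalWeight d N) ^ q := by positivity
  gcongr
  nlinarith [mul_nonneg hA₁0 p2, mul_nonneg hA₂0 p1]
end

/-! ### Growth of the weights and choice of the block ratio. -/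

theorem totalWeight_mono {d : ℕ → ℝ} (hd : ∀ k, 1 ≤ k → 0 < d k) : Monotone (totalWeight d) := by
  intro m n hmn
  refine Finset.sum_le_sum_of_subset_of_nonneg (Finset.Icc_subset_Icc_right hmn) fun k hk _ => ?_
  exact (hd k (Finset.mem_Icc.1 hk).1).le

theorem eventually_le_div_log_rpow (ρ c : ℝ) : ∀ᶠ y in atTop, c ≤ y / Real.log y ^ ρ := by
  have h := (isLittleO_log_rpow_rpow_atTop (s := (1 / 2 : ℝ)) ρ (by norm_num)).bound one_pos
  have h2 : Tendsto (fun y : ℝ => y ^ (1 / 2 : ℝ)) atTop atTop :=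
    tendsto_rpow_atTop (by norm_num)
  filter_upwards [h, h2.eventually_ge_atTop c, eventually_gt_atTop 1] with y hy hc h1
  have hl : 0 < Real.log y ^ ρ := Real.rpow_pos_of_pos (Real.log_pos h1) ρ
  have hs : 0 < y ^ (1 / 2 : ℝ) := Real.rpow_pos_of_pos (by linarith) _
  rw [one_mul, Real.norm_of_nonneg hl.le, Real.norm_of_nonneg hs.le] at hy
  refine hc.trans ((le_div_iff₀ hl).2 ?_)
  calc y ^ (1 / 2 : ℝ) * Real.log y ^ ρ ≤ y ^ (1 / 2 : ℝ) * y ^ (1 / 2 : ℝ) := by gcongr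
    _ = y := by rw [← Real.rpow_add (by linarith)]; norm_num

/-- A substitute for monotonicity of `x / (log x) ^ ρ`. If `x ≥ √y` then `log x ≥ (log y) / 2`,
whence the factor `2 ^ ρ`; if `x ≤ √y`, then `x` itself is below `y / (log y) ^ ρ`. -/
theorem eventually_div_log_rpow_le {ρ : ℝ} (hρ : 0 < ρ) :
    ∀ᶠ y in atTop, ∀ x, Real.exp 1 ≤ x → x ≤ y →
      x / Real.log x ^ ρ ≤ 2 ^ ρ * (y / Real.log y ^ ρ) := by
  have h := (isLittleO_log_rpow_rpow_atTop (s := (1 / 2 : ℝ)) ρ (by norm_num)).bound one_pos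
  filter_upwards [h, eventually_gt_atTop 1] with y hy h1 x hx hxy
  have hx0 : 0 < x := (Real.exp_pos 1).trans_le hx
  have hy0 : 0 < y := by linarith
  have hlx : 1 ≤ Real.log x := (Real.le_log_iff_exp_le hx0).2 hx
  have hly : 0 < Real.log y := Real.log_pos h1
  have hl : 0 < Real.log y ^ ρ := Real.rpow_pos_of_pos hly ρ
  have hs : 0 < y ^ (1 / 2 : ℝ) := Real.rpow_pos_of_pos hy0 _
  have h2 : (1 : ℝ) ≤ 2 ^ ρ := Real.one_le_rpow (by norm_num) hρ.le
  rw [one_mul, Real.norm_of_nonneg hl.le, Real.norm_of_nonneg hs.le] at hy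
  rcases le_total (y ^ (1 / 2 : ℝ)) x with hc | hc
  · have h3 : Real.log y / 2 ≤ Real.log x := by
      have := Real.log_le_log hs hc
      rw [Real.log_rpow hy0] at this
      linarith
    have h4 : (Real.log y / 2) ^ ρ ≤ Real.log x ^ ρ := Real.rpow_le_rpow (by positivity) h3 hρ.le
    rw [Real.div_rpow hly.le (by norm_num)] at h4
    calc x / Real.log x ^ ρ ≤ y / (Real.log y ^ ρ / 2 ^ ρ) := by gcongr
      _ = _ := by field_simp
  · have h3 : x / Real.log x ^ ρ ≤ x :=
      div_le_self hx0.le (Real.one_le_rpow hlx hρ.le)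
    have h4 : y ^ (1 / 2 : ℝ) ≤ y / Real.log y ^ ρ := by
      rw [le_div_iff₀ hl]
      calc y ^ (1 / 2 : ℝ) * Real.log y ^ ρ ≤ y ^ (1 / 2 : ℝ) * y ^ (1 / 2 : ℝ) := by gcongr
        _ = y := by rw [← Real.rpow_add hy0]; norm_num
    calc _ ≤ y / Real.log y ^ ρ := h3.trans (hc.trans h4)
      _ ≤ _ := le_mul_of_one_le_left (by positivity) h2

/-- Transfers (C₃) from `D_k` to `D_N` uniformly in `k ≤ N`. The finitely many `k` not covered by
the asymptotic bound are absorbed because `D_N / (log D_N) ^ ρ` is unbounded. -/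
theorem exists_eventually_mul_weight_le {d : ℕ → ℝ} (hd : ∀ k, 1 ≤ k → 0 < d k)
    (hD : Tendsto (totalWeight d) atTop atTop) {ρ : ℝ} (hρ : 0 < ρ)
    (hdD : d =O[atTop]
      (fun k : ℕ => totalWeight d k / ((k : ℝ) * (Real.log (totalWeight d k)) ^ ρ))) :
    ∃ C : ℝ, 0 < C ∧ ∀ᶠ N in atTop, ∀ k, 1 ≤ k → k ≤ N →
      k * d k ≤ C * (totalWeight d N / Real.log (totalWeight d N) ^ ρ) := by
  obtain ⟨c, hc, hcb⟩ := hdD.exists_pos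
  rw [IsBigOWith] at hcb
  obtain ⟨k₁, hk₁⟩ := eventually_atTop.1 (hcb.and (hD.eventually_ge_atTop (Real.exp 1)))
  refine ⟨c * 2 ^ ρ + 1, by positivity, ?_⟩
  set s : ℝ := ∑ k ∈ Finset.range k₁, |k * d k|
  filter_upwards [hD.eventually (eventually_div_log_rpow_le hρ),
    hD.eventually (eventually_le_div_log_rpow ρ s),
    hD.eventually (eventually_le_div_log_rpow ρ 0)] with N h1 h2 h0 k hk hkN
  rcases lt_or_ge k k₁ with hlt | hge
  · calc k * d k ≤ |k * d k| := le_abs_self _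
      _ ≤ s := Finset.single_le_sum (f := fun k : ℕ => |k * d k|) (fun _ _ => abs_nonneg _)
          (Finset.mem_range.2 hlt)
      _ ≤ 1 * (totalWeight d N / Real.log (totalWeight d N) ^ ρ) := by rw [one_mul]; exact h2
      _ ≤ _ := by gcongr; linarith [show 0 < c * 2 ^ ρ by positivity]
  · obtain ⟨hb, he⟩ := hk₁ k hge
    have hk0 : (0 : ℝ) < k := by exact_mod_cast hk
    have hDk : 0 < totalWeight d k := (Real.exp_pos 1).trans_le he
    have hlog : 1 ≤ Real.log (totalWeight d k) := (Real.le_log_iff_exp_le hDk).2 he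
    have hlog' : 0 < Real.log (totalWeight d k) ^ ρ := Real.rpow_pos_of_pos (by linarith) ρ
    rw [Real.norm_of_nonneg (hd k hk).le, Real.norm_of_nonneg (by positivity)] at hb
    have h3 := h1 _ he (totalWeight_mono hd hkN)
    calc k * d k ≤ k * (c * (totalWeight d k / (k * Real.log (totalWeight d k) ^ ρ))) := by gcongr
      _ = c * (totalWeight d k / Real.log (totalWeight d k) ^ ρ) := by field_simp
      _ ≤ c * (2 ^ ρ * (totalWeight d N / Real.log (totalWeight d N) ^ ρ)) := by gcongr
      _ = (c * 2 ^ ρ) * (totalWeight d N / Real.log (totalWeight d N) ^ ρ) := by ring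
      _ ≤ _ := by gcongr; linarith

theorem inv_le_two_mul_log_sub {k : ℕ} (hk : 1 ≤ k) :
    (k : ℝ)⁻¹ ≤ 2 * (Real.log ((k + 1 : ℕ) : ℝ) - Real.log k) := by
  have hk1 : (1 : ℝ) ≤ k := by exact_mod_cast hk
  have hk0 : (0 : ℝ) < k := by linarith
  push_cast
  rw [← Real.log_div (by positivity) (by positivity)]
  have h := Real.one_sub_inv_le_log_of_pos (x := ((k : ℝ) + 1) / k) (by positivity)
  have e : 1 - (((k : ℝ) + 1) / k)⁻¹ = ((k : ℝ) + 1)⁻¹ := by field_simp; ring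
  rw [e] at h
  have h2 : (k : ℝ)⁻¹ ≤ 2 * ((k : ℝ) + 1)⁻¹ := by
    rw [← div_eq_mul_inv, inv_eq_one_div, div_le_div_iff₀ hk0 (by positivity)]
    linarith
  linarith

theorem sum_block_inv_le {R : ℕ} (hR : 2 ≤ R) (N j : ℕ) :
    ∑ k ∈ Finset.Icc 1 N with Nat.log R k = j, (k : ℝ)⁻¹ ≤ 2 * Real.log R := by
  calc _ ≤ ∑ k ∈ Finset.Ico (R ^ j) (R ^ (j + 1)), (k : ℝ)⁻¹ := by
        refine Finset.sum_le_sum_of_subset_of_nonneg (fun k hk => ?_) fun k _ _ => by positivity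
        obtain ⟨hk1, rfl⟩ := Finset.mem_filter.1 hk
        exact Finset.mem_Ico.2 ⟨Nat.pow_log_le_self R (by have := Finset.mem_Icc.1 hk1; omega),
          Nat.lt_pow_succ_log_self (by omega) k⟩
    _ ≤ ∑ k ∈ Finset.Ico (R ^ j) (R ^ (j + 1)),
          2 * (Real.log ((k + 1 : ℕ) : ℝ) - Real.log (k : ℝ)) := by
        refine Finset.sum_le_sum fun k hk => inv_le_two_mul_log_sub ?_
        exact (Nat.one_le_pow _ _ (by omega)).trans (Finset.mem_Ico.1 hk).1
    _ = 2 * Real.log R := by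
        rw [← Finset.mul_sum, Finset.sum_Ico_sub (fun k : ℕ => Real.log (k : ℝ))
          (Nat.pow_le_pow_right (by omega) (by omega))]
        push_cast
        rw [Real.log_pow, Real.log_pow]
        push_cast
        ring

/-- Take `R` about `L ^ (ρ / (2β))`: the truncation error gains `L ^ (-ρ/2)`, while `log R` is of
order `log L`, below any power of `L`. The added 1 in the witness ensures `R ≥ 2`. -/
theorem exists_blockRatio {β ρ ε : ℝ} (hβ : 0 < β) (hρ : 0 < ρ) (hε : 0 < ε) :
    ∃ c : ℝ, 0 < c ∧ ∀ L : ℝ, 1 ≤ L → ∃ R : ℕ, 2 ≤ R ∧ (R : ℝ)⁻¹ ^ β ≤ L ^ (-(ρ / 2)) ∧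
      Real.log R ≤ c * L ^ ε := by
  set c : ℝ := ρ / (2 * β) with hc
  have hc0 : 0 < c := by positivity
  refine ⟨2 + c / ε, by positivity, fun L hL => ⟨⌈L ^ c⌉₊ + 1, ?_, ?_, ?_⟩⟩
  · have : 0 < ⌈L ^ c⌉₊ := Nat.ceil_pos.2 (by positivity)
    omega
  · have h1 : L ^ c ≤ ((⌈L ^ c⌉₊ + 1 : ℕ) : ℝ) := by
      push_cast; linarith [Nat.le_ceil (L ^ c)]
    have h2 : L ^ (ρ / 2) ≤ ((⌈L ^ c⌉₊ + 1 : ℕ) : ℝ) ^ β := by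
      calc L ^ (ρ / 2) = (L ^ c) ^ β := by
            rw [← Real.rpow_mul (by linarith), hc]; congr 1; field_simp
        _ ≤ _ := Real.rpow_le_rpow (by positivity) h1 hβ.le
    rw [Real.inv_rpow (by positivity), Real.rpow_neg (by linarith)]
    exact inv_anti₀ (by positivity) h2
  · have hLc : 1 ≤ L ^ c := Real.one_le_rpow hL hc0.le
    have hLε : 1 ≤ L ^ ε := Real.one_le_rpow hL hε.le
    have h1 : ((⌈L ^ c⌉₊ + 1 : ℕ) : ℝ) ≤ 3 * L ^ c := by
      push_cast
      linarith [(Nat.ceil_lt_add_one (by positivity : 0 ≤ L ^ c)).le]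
    calc Real.log ((⌈L ^ c⌉₊ + 1 : ℕ) : ℝ) ≤ Real.log (3 * L ^ c) :=
          Real.log_le_log (by positivity) h1
      _ = Real.log 3 + c * Real.log L := by
          rw [Real.log_mul (by norm_num) (by positivity), Real.log_rpow (by linarith)]
      _ ≤ 2 * L ^ ε + c * (L ^ ε / ε) := by
          have h3 : Real.log 3 ≤ 2 := by
            have := Real.log_le_sub_one_of_pos (x := 3) (by norm_num); linarith
          have h4 := Real.log_le_rpow_div (by linarith : 0 ≤ L) hε
          gcongr
          linarith
      _ = _ := by ring

section
variable {Ω : Type*} {X : ℕ → Ω → ℝ} {a b : ℕ → ℝ}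
variable [MeasurableSpace Ω] {P : Measure Ω} [IsProbabilityMeasure P]

theorem exists_integral_weighted_sum_pow_le (hX : ∀ i, Measurable (X i)) (hind : iIndepFun X P)
    (ha : ∀ n, 1 ≤ n → 0 < a n) {C β : ℝ} (hC : 0 < C) (hβ : 0 < β)
    (hab : ∀ k l : ℕ, 1 ≤ k → k ≤ l → a k / a l ≤ C * ((k : ℝ) / (l : ℝ)) ^ β)
    {q : ℕ} (hq : 1 ≤ q) (hLp : ∀ k, MemLp (normSum X a b k) (2 * q : ℕ) P) {M : ℝ}
    (hM : ∀ k, 1 ≤ k → ∫ ω, normSum X a b k ω ^ (2 * q) ∂P ≤ M)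
    {d : ℕ → ℝ} (hd : ∀ k, 1 ≤ k → 0 < d k) (hD : Tendsto (totalWeight d) atTop atTop)
    {ρ : ℝ} (hρ : 0 < ρ) (hdD : d =O[atTop]
      (fun k : ℕ => totalWeight d k / ((k : ℝ) * (Real.log (totalWeight d k)) ^ ρ)))
    {f : ℝ → ℝ} {K : ℝ≥0} (hf : LipschitzWith K f) {σ : ℝ} (hσ : σ < ρ * q) :
    ∃ A : ℝ, 0 ≤ A ∧ ∀ᶠ N in atTop, ∫ ω, (∑ k ∈ Finset.Icc 1 N,
        d k * (f (normSum X a b k ω) - ∫ ω', f (normSum X a b k ω') ∂P)) ^ (2 * q) ∂P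
        ≤ A * (totalWeight d N ^ (2 * q) * Real.log (totalWeight d N) ^ (-σ)) := by
  obtain ⟨A, hA, hAb⟩ := integral_weighted_sum_pow_le hX hind ha hC hβ hab hq hLp hM hd hf
  obtain ⟨B, hB, hBb⟩ := exists_eventually_mul_weight_le hd hD hρ hdD
  have hq0 : (0 : ℝ) < q := by exact_mod_cast hq
  -- This exponent is the price allowed for `log R`: after the `q`-th power, `L ^ (-ρ q)` weakens
  -- exactly to `L ^ (-σ)`.
  have hε : 0 < ρ - σ / q := by rw [sub_pos, div_lt_iff₀ hq0]; exact hσ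
  obtain ⟨c, hc, hcR⟩ := exists_blockRatio hβ hρ hε
  refine ⟨A * (1 + (B * (2 * c)) ^ q), by positivity, ?_⟩
  filter_upwards [hBb, hD.eventually_ge_atTop (Real.exp 1)] with N hN he
  set D := totalWeight d N
  have hD0 : 0 < D := (Real.exp_pos 1).trans_le he
  set L := Real.log D
  have hL : 1 ≤ L := (Real.le_log_iff_exp_le hD0).2 he
  have hL0 : 0 < L := by linarith
  obtain ⟨R, hR, hRβ, hRlog⟩ := hcR L hL
  refine (hAb R hR N (B * (D / L ^ ρ) * (2 * (c * L ^ (ρ - σ / q)))) fun j => ?_).trans ?_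
  · calc _ ≤ ∑ k ∈ Finset.Icc 1 N with Nat.log R k = j, B * (D / L ^ ρ) * (k : ℝ)⁻¹ := by
          refine Finset.sum_le_sum fun k hk => ?_
          obtain ⟨h1, h2⟩ := Finset.mem_Icc.1 (Finset.mem_filter.1 hk).1
          have hk0 : (0 : ℝ) < k := by exact_mod_cast h1
          rw [← div_eq_mul_inv, le_div_iff₀ hk0, mul_comm]
          exact hN k h1 h2
      _ ≤ _ := by
          rw [← Finset.mul_sum]
          have := (sum_block_inv_le hR N j).trans (mul_le_mul_of_nonneg_left hRlog zero_le_two)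
          gcongr
  · have h1 : (D * (R : ℝ)⁻¹ ^ β) ^ (2 * q) ≤ D ^ (2 * q) * L ^ (-σ) := by
      calc (D * (R : ℝ)⁻¹ ^ β) ^ (2 * q) ≤ (D * L ^ (-(ρ / 2))) ^ (2 * q) := by gcongr
        _ = D ^ (2 * q) * L ^ (-(ρ * q)) := by
            rw [mul_pow, ← Real.rpow_natCast (L ^ _), ← Real.rpow_mul hL0.le]
            congr 2; push_cast; ring
        _ ≤ _ := by gcongr
    have h2 : (B * (D / L ^ ρ) * (2 * (c * L ^ (ρ - σ / q))) * D) ^ q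
        = (B * (2 * c)) ^ q * (D ^ (2 * q) * L ^ (-σ)) := by
      have e : B * (D / L ^ ρ) * (2 * (c * L ^ (ρ - σ / q))) * D
          = B * (2 * c) * (D ^ 2 * L ^ (-σ / q)) := by
        rw [Real.rpow_sub hL0, neg_div, Real.rpow_neg hL0.le]
        field_simp
      rw [e, mul_pow, mul_pow (D ^ 2), ← pow_mul, ← Real.rpow_natCast (L ^ _),
        ← Real.rpow_mul hL0.le, div_mul_cancel₀ _ hq0.ne']
    rw [h2, mul_assoc A]
    refine mul_le_mul_of_nonneg_left ?_ hA
    rw [add_mul, one_mul]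
    gcongr
end

/-! ### Interpolation from a subsequence, and the choice of that subsequence. -/

/-- A nonnegative monotone sequence divided by a monotone sequence converges as soon as it does so
along a subsequence on which consecutive denominators have ratio tending to one. -/
theorem tendsto_div_of_monotone_of_subseq {u D : ℕ → ℝ} (hu : Monotone u) (hu0 : ∀ n, 0 ≤ u n)
    (hDm : Monotone D) (hDpos : ∀ᶠ n in atTop, 0 < D n) {c : ℕ → ℕ} (hc : Tendsto c atTop atTop)
    (hratio : Tendsto (fun j => D (c (j + 1)) / D (c j)) atTop (𝓝 1)) {l : ℝ}
    (hlim : Tendsto (fun j => u (c j) / D (c j)) atTop (𝓝 l)) :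
    Tendsto (fun N => u N / D N) atTop (𝓝 l) := by
  have hex : ∀ N, ∃ j, N < c j := fun N => (hc.eventually_gt_atTop N).exists
  -- Predecessor of the first `j` with `N < c j`, so that `c (J N) ≤ N < c (J N + 1)` once `N ≥ c
  -- 0`; `c` need not be monotone.
  set J : ℕ → ℕ := fun N => Nat.find (hex N) - 1 with hJ
  have hJt : Tendsto J atTop atTop := by
    rw [tendsto_atTop]
    intro m
    filter_upwards [(Filter.eventually_all_finset (Finset.range (m + 1))).2
      fun i _ => eventually_ge_atTop (c i)] with N hN
    have : m + 1 ≤ Nat.find (hex N) := by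
      rw [Nat.le_find_iff]
      intro i hi
      exact not_lt.2 (hN i (Finset.mem_range.2 hi))
    simp only [hJ]; omega
  have hJ1 : ∀ᶠ N in atTop, c (J N) ≤ N ∧ N < c (J N + 1) := by
    filter_upwards [eventually_ge_atTop (c 0)] with N hN
    have h1 : Nat.find (hex N) ≠ 0 := by
      intro h
      have := Nat.find_spec (hex N)
      rw [h] at this
      omega
    refine ⟨not_lt.1 (Nat.find_min (hex N) (by simp only [hJ]; omega)), ?_⟩
    have e : J N + 1 = Nat.find (hex N) := by simp only [hJ]; omega
    rw [e]
    exact Nat.find_spec (hex N)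
  have hlo : Tendsto (fun j => u (c j) / D (c j) / (D (c (j + 1)) / D (c j))) atTop (𝓝 l) := by
    simpa [Pi.div_def] using hlim.div hratio one_ne_zero
  have hhi : Tendsto (fun j => u (c (j + 1)) / D (c (j + 1)) * (D (c (j + 1)) / D (c j)))
      atTop (𝓝 l) := by
    simpa using (hlim.comp (tendsto_add_atTop_nat 1)).mul hratio
  have hpos : ∀ᶠ j in atTop, 0 < D (c j) := hc.eventually hDpos
  refine tendsto_of_tendsto_of_tendsto_of_le_of_le' (hlo.comp hJt) (hhi.comp hJt) ?_ ?_
  · filter_upwards [hJ1, hJt.eventually hpos, hDpos] with N h1 h2 h3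
    have h4 := hDm h1.2.le
    have h5 : 0 < D (c (J N + 1)) := h3.trans_le h4
    have h6 := hu h1.1
    have h7 := hu0 N
    simp only [Function.comp_apply]
    rw [div_div_div_cancel_right₀ h2.ne']
    gcongr
  · filter_upwards [hJ1, hJt.eventually hpos, hDpos] with N h1 h2 h3
    have h4 := hDm h1.1
    have h5 : 0 < D (c (J N + 1)) := h3.trans_le (hDm h1.2.le)
    have h6 := hu h1.2.le
    have h7 := hu0 (c (J N + 1))
    simp only [Function.comp_apply]
    rw [div_mul_div_cancel₀ h5.ne']
    gcongr

/-- By Bernoulli's inequality for exponents below one, the increment is at most `γ * j ^ (γ - 1)`.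
-/
theorem tendsto_rpow_add_one_sub {γ : ℝ} (h0 : 0 < γ) (h1 : γ < 1) :
    Tendsto (fun j : ℕ => ((j + 1 : ℕ) : ℝ) ^ γ - (j : ℝ) ^ γ) atTop (𝓝 0) := by
  have hlim : Tendsto (fun j : ℕ => γ * (j : ℝ) ^ (-(1 - γ))) atTop (𝓝 0) := by
    simpa using ((tendsto_rpow_neg_atTop (by linarith : 0 < 1 - γ)).comp
      tendsto_natCast_atTop_atTop).const_mul γ
  refine tendsto_of_tendsto_of_tendsto_of_le_of_le' tendsto_const_nhds hlim ?_ ?_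
  · filter_upwards with j
    rw [sub_nonneg]
    exact Real.rpow_le_rpow (by positivity) (by push_cast; linarith) h0.le
  · filter_upwards [eventually_gt_atTop 0] with j hj
    have hj0 : (0 : ℝ) < j := by exact_mod_cast hj
    have e : ((j + 1 : ℕ) : ℝ) = j * (1 + (j : ℝ)⁻¹) := by push_cast; field_simp
    have h2 := rpow_one_add_le_one_add_mul_self (s := (j : ℝ)⁻¹)
      (by linarith [inv_pos.2 hj0]) h0.le h1.le
    rw [e, Real.mul_rpow hj0.le (by positivity), neg_sub, Real.rpow_sub hj0, Real.rpow_one]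
    calc (j : ℝ) ^ γ * (1 + (j : ℝ)⁻¹) ^ γ - (j : ℝ) ^ γ
        ≤ (j : ℝ) ^ γ * (1 + γ * (j : ℝ)⁻¹) - (j : ℝ) ^ γ := by gcongr
      _ = _ := by ring

/-- Let `c j` be the first index where `D` reaches `exp (j ^ γ)`. As `γ < 1`, consecutive thresholds
have ratio tending to one, and the overshoot is controlled by `D (n+1) / D n`. The condition on `D
0` forces `c j ≥ 1`, so the index before `c j` exists. -/
theorem exists_subseq_exp_rpow {D : ℕ → ℝ} (hDm : Monotone D) (hD0 : D 0 ≤ 0)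
    (hD : Tendsto D atTop atTop) (hstep : Tendsto (fun n => D (n + 1) / D n) atTop (𝓝 1))
    {γ : ℝ} (h0 : 0 < γ) (h1 : γ < 1) :
    ∃ c : ℕ → ℕ, Tendsto c atTop atTop ∧ (∀ j : ℕ, Real.exp ((j : ℝ) ^ γ) ≤ D (c j)) ∧
      Tendsto (fun j => D (c (j + 1)) / D (c j)) atTop (𝓝 1) := by
  have hex : ∀ j : ℕ, ∃ N, Real.exp ((j : ℝ) ^ γ) ≤ D N := fun j =>
    (hD.eventually_ge_atTop _).exists
  set c : ℕ → ℕ := fun j => Nat.find (hex j)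
  have hcle : ∀ j : ℕ, Real.exp ((j : ℝ) ^ γ) ≤ D (c j) := fun j => Nat.find_spec (hex j)
  have hc1 : ∀ j, 1 ≤ c j := by
    intro j
    by_contra h
    have h2 := hcle j
    rw [show c j = 0 by omega] at h2
    linarith [Real.exp_pos ((j : ℝ) ^ γ)]
  have hcm : ∀ j, c j ≤ c (j + 1) := fun j => Nat.find_min' _ <| by
    refine le_trans (Real.exp_le_exp.2 (Real.rpow_le_rpow (by positivity) ?_ h0.le)) (hcle (j + 1))
    push_cast; linarith
  have hct : Tendsto c atTop atTop := by
    have hexp : Tendsto (fun j : ℕ => D (c j)) atTop atTop :=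
      tendsto_atTop_mono hcle (Real.tendsto_exp_atTop.comp
        ((tendsto_rpow_atTop h0).comp tendsto_natCast_atTop_atTop))
    rw [tendsto_atTop]
    intro m
    filter_upwards [hexp.eventually_gt_atTop (D m)] with j hj
    exact (hDm.reflect_lt hj).le
  have hpos : ∀ j, 0 < D (c j) := fun j => (Real.exp_pos _).trans_le (hcle j)
  have hc' : Tendsto (fun j => c (j + 1) - 1) atTop atTop :=
    (tendsto_sub_atTop_nat 1).comp (hct.comp (tendsto_add_atTop_nat 1))
  refine ⟨c, hct, hcle, ?_⟩
  have hup : Tendsto (fun j : ℕ => D (c (j + 1) - 1 + 1) / D (c (j + 1) - 1)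
      * Real.exp (((j + 1 : ℕ) : ℝ) ^ γ - (j : ℝ) ^ γ)) atTop (𝓝 1) := by
    have h2 := (Real.continuous_exp.tendsto 0).comp (tendsto_rpow_add_one_sub h0 h1)
    simpa [Function.comp_def] using (hstep.comp hc').mul h2
  refine tendsto_of_tendsto_of_tendsto_of_le_of_le' tendsto_const_nhds hup ?_ ?_
  · filter_upwards with j
    rw [le_div_iff₀ (hpos j), one_mul]
    exact hDm (hcm j)
  · filter_upwards [hc'.eventually (hD.eventually_gt_atTop 0)] with j hj
    have hlt : D (c (j + 1) - 1) < Real.exp (((j + 1 : ℕ) : ℝ) ^ γ) := by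
      have h2 := Nat.find_min (hex (j + 1)) (m := c (j + 1) - 1) (Nat.sub_lt (hc1 _) one_pos)
      exact not_le.1 h2
    rw [Nat.sub_add_cancel (hc1 _), Real.exp_sub, div_mul_div_comm,
      div_le_div_iff₀ (hpos j) (by positivity)]
    have hD1 := (hpos (j + 1)).le
    have h3 : D (c (j + 1) - 1) * Real.exp ((j : ℝ) ^ γ)
        ≤ Real.exp (((j + 1 : ℕ) : ℝ) ^ γ) * D (c j) :=
      mul_le_mul hlt.le (hcle j) (Real.exp_pos _).le (Real.exp_pos _).le
    calc _ ≤ D (c (j + 1)) * (Real.exp (((j + 1 : ℕ) : ℝ) ^ γ) * D (c j)) :=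
          mul_le_mul_of_nonneg_left h3 hD1
      _ = _ := by ring

/-! ### Almost sure convergence from moments, and weighted averages. -/

section
variable {Ω : Type*} [MeasurableSpace Ω] {P : Measure Ω}

/-- The series of the powers has finite expectation, hence converges almost surely, so its terms
tend to zero. -/
theorem ae_tendsto_zero_of_summable_integral_pow {p : ℕ} (hp : Even p)
    {g : ℕ → Ω → ℝ} (hg : ∀ j, Integrable (fun ω => g j ω ^ p) P) {B : ℕ → ℝ} (hB : Summable B)
    (hgB : ∀ᶠ j in atTop, ∫ ω, g j ω ^ p ∂P ≤ B j) :
    ∀ᵐ ω ∂P, Tendsto (fun j => g j ω) atTop (𝓝 0) := by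
  obtain ⟨j₀, hj₀⟩ := eventually_atTop.1 hgB
  have hnn : ∀ j, 0 ≤ ∫ ω, g j ω ^ p ∂P := fun j => integral_nonneg fun ω => hp.pow_nonneg _
  have hsum : Summable fun j => ∫ ω, g (j + j₀) ω ^ p ∂P :=
    Summable.of_nonneg_of_le (fun j => hnn _) (fun j => hj₀ _ (by omega))
      ((summable_nat_add_iff j₀).2 hB)
  have hfin : ∫⁻ ω, ∑' j, ENNReal.ofReal (g (j + j₀) ω ^ p) ∂P ≠ ∞ := by
    rw [lintegral_tsum fun j => (hg _).aemeasurable.ennreal_ofReal]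
    have e : ∀ j, ∫⁻ ω, ENNReal.ofReal (g (j + j₀) ω ^ p) ∂P
        = ENNReal.ofReal (∫ ω, g (j + j₀) ω ^ p ∂P) := fun j =>
      (ofReal_integral_eq_lintegral_ofReal (hg _) (ae_of_all _ fun ω => hp.pow_nonneg _)).symm
    simp only [e]
    exact hsum.tsum_ofReal_ne_top
  have hae := ae_lt_top' (AEMeasurable.tsum fun j =>
    (hg (j + j₀)).aemeasurable.ennreal_ofReal) hfin
  filter_upwards [hae] with ω hω
  have h1 := ENNReal.tendsto_atTop_zero_of_tsum_ne_top hω.ne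
  have h2 : Tendsto (fun j => g (j + j₀) ω ^ p) atTop (𝓝 0) := by
    have := (ENNReal.tendsto_toReal ENNReal.zero_ne_top).comp h1
    simpa [Function.comp_def, ENNReal.toReal_ofReal (hp.pow_nonneg _)] using this
  rw [← tendsto_add_atTop_iff_nat j₀, Metric.tendsto_atTop]
  intro ε hε
  obtain ⟨n, hn⟩ := Metric.tendsto_atTop.1 h2 (ε ^ p) (by positivity)
  refine ⟨n, fun m hm => ?_⟩
  have h3 := hn m hm
  rw [Real.dist_eq, sub_zero, abs_pow] at h3
  rw [Real.dist_eq, sub_zero]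
  exact lt_of_pow_lt_pow_left₀ p hε.le h3

theorem tendsto_weighted_average {d e : ℕ → ℝ} (hd : ∀ k, 1 ≤ k → 0 < d k)
    (hD : Tendsto (totalWeight d) atTop atTop) {l : ℝ} (he : Tendsto e atTop (𝓝 l)) :
    Tendsto (fun N => (∑ k ∈ Finset.Icc 1 N, d k * e k) / totalWeight d N) atTop (𝓝 l) := by
  have hIcc : ∀ (g : ℕ → ℝ) (N : ℕ), ∑ k ∈ Finset.Icc 1 N, g k
      = ∑ k ∈ Finset.range N, g (k + 1) := by
    intro g N
    rw [Finset.range_eq_Ico, Finset.sum_Ico_add' g 0 N 1]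
    rfl
  have ho : (fun k => d (k + 1) * (e (k + 1) - l)) =o[atTop] fun k => d (k + 1) := by
    have h1 : (fun k => e (k + 1) - l) =o[atTop] fun _ => (1 : ℝ) := by
      rw [isLittleO_one_iff]
      simpa using (he.comp (tendsto_add_atTop_nat 1)).sub_const l
    simpa using (isBigO_refl (fun k => d (k + 1)) atTop).mul_isLittleO h1
  have hD' : Tendsto (fun N => ∑ k ∈ Finset.range N, d (k + 1)) atTop atTop := by
    simp only [← hIcc]
    exact hD
  have h2 := ho.sum_range (fun k => (hd (k + 1) (by omega)).le) hD'
  simp only [← hIcc d, ← hIcc (fun k => d k * (e k - l))] at h2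
  have h3 := h2.tendsto_div_nhds_zero.add_const l
  rw [zero_add] at h3
  refine h3.congr' ?_
  filter_upwards [hD.eventually_gt_atTop 0] with N hN
  change _ / totalWeight d N + l = _
  rw [eq_div_iff hN.ne', add_mul, div_mul_cancel₀ _ hN.ne']
  rw [totalWeight]
  simp only [mul_sub, Finset.sum_sub_distrib, ← Finset.sum_mul]
  linarith
end

/-! ### Convergence of expectations of unbounded Lipschitz functions. -/

/-- Clamping changes `x` only when `|x| > R`, where `|x| ≤ x ^ 2 / R`; thus a second moment bound
controls the tails uniformly. -/
theorem abs_sub_clamp_le {R : ℝ} (hR : 0 < R) (x : ℝ) : |x - max (-R) (min R x)| ≤ x ^ 2 / R := by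
  have h0 : 0 ≤ x ^ 2 / R := by positivity
  rcases le_total R x with h | h
  · rw [min_eq_left h, max_eq_right (by linarith), abs_of_nonneg (by linarith), le_div_iff₀ hR]
    nlinarith
  · rw [min_eq_right h]
    rcases le_total (-R) x with h' | h'
    · rw [max_eq_right h']; simpa using h0
    · rw [max_eq_left h', abs_of_nonpos (by linarith), le_div_iff₀ hR]
      nlinarith

theorem abs_clamp_le {R : ℝ} (hR : 0 ≤ R) (x : ℝ) : |max (-R) (min R x)| ≤ R :=
  abs_le.2 ⟨le_max_left _ _, max_le (by linarith) (min_le_left _ _)⟩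

theorem abs_clamp_le_abs {R : ℝ} (hR : 0 ≤ R) (x : ℝ) : |max (-R) (min R x)| ≤ |x| := by
  rcases le_total R x with h | h
  · rw [min_eq_left h, max_eq_right (by linarith)]; exact abs_le_abs h (by linarith)
  · rw [min_eq_right h]
    rcases le_total (-R) x with h' | h'
    · rw [max_eq_right h']
    · rw [max_eq_left h', abs_neg, abs_of_nonneg hR]; exact le_trans (by linarith) (neg_le_abs x)

section
variable {Ω : Type*} [MeasurableSpace Ω] {P : Measure Ω} [IsProbabilityMeasure P]
  {H : Measure ℝ} [IsProbabilityMeasure H] {Z : ℕ → Ω → ℝ}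

theorem tendsto_integral_of_tendstoInDistribution
    (hZ : TendstoInDistribution Z atTop (id : ℝ → ℝ) (fun _ => P) H) {g : ℝ → ℝ}
    (hg : Continuous g) {B : ℝ} (hB : ∀ x, |g x| ≤ B) :
    Tendsto (fun n => ∫ ω, g (Z n ω) ∂P) atTop (𝓝 (∫ x, g x ∂H)) := by
  have h := (ProbabilityMeasure.tendsto_iff_forall_integral_tendsto.1 hZ.tendsto)
    (BoundedContinuousFunction.ofNormedAddCommGroup g hg B hB)
  simp only [ProbabilityMeasure.coe_mk, BoundedContinuousFunction.coe_ofNormedAddCommGroup,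
    Measure.map_id] at h
  refine h.congr fun n => ?_
  exact integral_map (hZ.forall_aemeasurable n) hg.aestronglyMeasurable

/-- Clamped squares are bounded and continuous, so their `H`-integrals inherit the bound `M`;
Fatou's lemma removes the clamp. -/
theorem memLp_two_of_tendstoInDistribution
    (hZ : TendstoInDistribution Z atTop (id : ℝ → ℝ) (fun _ => P) H)
    (hLp : ∀ n, MemLp (Z n) 2 P) {M : ℝ} (hM : ∀ n, 1 ≤ n → ∫ ω, Z n ω ^ 2 ∂P ≤ M) :
    MemLp (id : ℝ → ℝ) 2 H := by
  set g : ℕ → ℝ → ℝ := fun R x => max (-(R : ℝ)) (min (R : ℝ) x) with hg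
  have hgc : ∀ R, Continuous (g R) := fun R => by fun_prop
  have hb : ∀ R x, |g R x ^ 2| ≤ (R : ℝ) ^ 2 := fun R x => by
    rw [abs_pow]
    exact pow_le_pow_left₀ (abs_nonneg _) (abs_clamp_le (Nat.cast_nonneg R) x) 2
  have hle : ∀ R, ∫ x, g R x ^ 2 ∂H ≤ M := by
    intro R
    refine le_of_tendsto (tendsto_integral_of_tendstoInDistribution hZ ((hgc R).pow 2) (hb R)) ?_
    filter_upwards [eventually_ge_atTop 1] with n hn
    refine le_trans (integral_mono_of_nonneg (ae_of_all _ fun ω => sq_nonneg _)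
      (hLp n).integrable_sq (ae_of_all _ fun ω => ?_)) (hM n hn)
    exact sq_le_sq.2 (abs_clamp_le_abs (Nat.cast_nonneg R) _)
  have hlim : ∀ x : ℝ, Tendsto (fun R : ℕ => ENNReal.ofReal (g R x ^ 2)) atTop
      (𝓝 (ENNReal.ofReal (x ^ 2))) := by
    intro x
    refine tendsto_const_nhds.congr' ?_
    filter_upwards [eventually_ge_atTop ⌈|x|⌉₊] with R hR
    have h1 : |x| ≤ R := (Nat.le_ceil _).trans (by exact_mod_cast hR)
    obtain ⟨h2, h3⟩ := abs_le.1 h1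
    simp only [hg]
    rw [min_eq_right h3, max_eq_right h2]
  have hint : ∫⁻ x, ENNReal.ofReal (x ^ 2) ∂H ≤ ENNReal.ofReal M := by
    calc ∫⁻ x, ENNReal.ofReal (x ^ 2) ∂H
        = ∫⁻ x, liminf (fun R : ℕ => ENNReal.ofReal (g R x ^ 2)) atTop ∂H :=
          lintegral_congr fun x => (hlim x).liminf_eq.symm
      _ ≤ liminf (fun R : ℕ => ∫⁻ x, ENNReal.ofReal (g R x ^ 2) ∂H) atTop :=
          lintegral_liminf_le fun R => ((hgc R).pow 2).measurable.ennreal_ofReal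
      _ ≤ ENNReal.ofReal M := by
          refine liminf_le_of_le (by isBoundedDefault) fun b hb' => ?_
          obtain ⟨R, hR⟩ := hb'.exists
          refine hR.trans ?_
          have hgi : Integrable (fun x => g R x ^ 2) H :=
            Integrable.of_bound ((hgc R).pow 2).aestronglyMeasurable _ (ae_of_all _ (hb R))
          rw [← ofReal_integral_eq_lintegral_ofReal hgi (ae_of_all _ fun x => sq_nonneg _)]
          exact ENNReal.ofReal_le_ofReal (hle R)
  rw [memLp_two_iff_integrable_sq continuous_id.aestronglyMeasurable]
  refine ⟨(continuous_id.pow 2).aestronglyMeasurable, ?_⟩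
  rw [hasFiniteIntegral_iff_ofReal (ae_of_all _ fun x => sq_nonneg _)]
  exact hint.trans_lt ENNReal.ofReal_lt_top

theorem abs_integral_sub_integral_clamp_le {Y : Ω → ℝ} (hY : MemLp Y 2 P) {B R : ℝ}
    (hB : ∫ ω, Y ω ^ 2 ∂P ≤ B) (hR : 0 < R) {f : ℝ → ℝ} {K : ℝ≥0} (hf : LipschitzWith K f) :
    |∫ ω, f (Y ω) ∂P - ∫ ω, f (max (-R) (min R (Y ω))) ∂P| ≤ K * B / R := by
  have hcl : MemLp (fun ω => max (-R) (min R (Y ω))) 2 P := by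
    refine hY.mono ?_ (ae_of_all _ fun ω => abs_clamp_le_abs hR.le _)
    exact (by fun_prop : Continuous fun x : ℝ => max (-R) (min R x)).comp_aestronglyMeasurable
      hY.aestronglyMeasurable
  have h1 : Integrable (fun ω => f (Y ω)) P := (hf.memLp_comp hY).integrable (by norm_num)
  have h2 : Integrable (fun ω => f (max (-R) (min R (Y ω)))) P :=
    (hf.memLp_comp hcl).integrable (by norm_num)
  rw [← integral_sub h1 h2]
  calc |∫ ω, (f (Y ω) - f (max (-R) (min R (Y ω)))) ∂P|
      ≤ ∫ ω, |f (Y ω) - f (max (-R) (min R (Y ω)))| ∂P := abs_integral_le_integral_abs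
    _ ≤ ∫ ω, K / R * Y ω ^ 2 ∂P := by
        refine integral_mono (h1.sub h2).abs (hY.integrable_sq.const_mul _) fun ω => ?_
        have h3 := hf.dist_le_mul (Y ω) (max (-R) (min R (Y ω)))
        rw [Real.dist_eq, Real.dist_eq] at h3
        refine h3.trans ?_
        have := abs_sub_clamp_le hR (Y ω)
        calc _ ≤ K * (Y ω ^ 2 / R) := by gcongr
          _ = _ := by ring
    _ = K / R * ∫ ω, Y ω ^ 2 ∂P := integral_const_mul _ _
    _ ≤ K / R * B := by gcongr
    _ = _ := by ring

theorem tendsto_integral_lipschitz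
    (hZ : TendstoInDistribution Z atTop (id : ℝ → ℝ) (fun _ => P) H)
    (hLp : ∀ n, MemLp (Z n) 2 P) {M : ℝ} (hM : ∀ n, 1 ≤ n → ∫ ω, Z n ω ^ 2 ∂P ≤ M)
    {f : ℝ → ℝ} {K : ℝ≥0} (hf : LipschitzWith K f) :
    Tendsto (fun n => ∫ ω, f (Z n ω) ∂P) atTop (𝓝 (∫ x, f x ∂H)) := by
  have hH := memLp_two_of_tendstoInDistribution hZ hLp hM
  set B : ℝ := max M (∫ x, x ^ 2 ∂H) with hB
  have hB0 : 0 ≤ B := le_max_of_le_right (integral_nonneg fun x => sq_nonneg x)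
  rw [Metric.tendsto_atTop]
  intro ε hε
  -- Each of the two clamping errors is at most `ε / 3`; the added 1 keeps `R` positive.
  set R : ℝ := 3 * (K * B + 1) / ε with hR
  have hR0 : 0 < R := by positivity
  have hRε : K * B / R ≤ ε / 3 := by
    rw [hR, div_le_iff₀ (by positivity)]
    field_simp
    linarith
  have hbd : ∀ x, |f (max (-R) (min R x))| ≤ K * R + |f 0| := by
    intro x
    have h1 := hf.dist_le_mul (max (-R) (min R x)) 0
    rw [Real.dist_eq, Real.dist_eq, sub_zero] at h1
    have h2 := abs_sub_abs_le_abs_sub (f (max (-R) (min R x))) (f 0)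
    have h3 := mul_le_mul_of_nonneg_left (abs_clamp_le hR0.le x) (NNReal.coe_nonneg K)
    linarith
  have ht := tendsto_integral_of_tendstoInDistribution hZ
    (hf.continuous.comp (by fun_prop : Continuous fun x : ℝ => max (-R) (min R x))) hbd
  obtain ⟨n₀, hn₀⟩ := Metric.tendsto_atTop.1 ht (ε / 3) (by positivity)
  refine ⟨max n₀ 1, fun n hn => ?_⟩
  have h1 := abs_integral_sub_integral_clamp_le (hLp n) (B := B) ((hM n ((le_max_right _ _).trans hn)).trans (le_max_left _ _))
    hR0 hf
  have h2 := abs_integral_sub_integral_clamp_le hH (B := B) (le_max_right _ _) hR0 hf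
  have h3 := hn₀ n ((le_max_left _ _).trans hn)
  rw [Real.dist_eq] at h3 ⊢
  simp only [Function.comp_apply, id_eq] at h2 h3
  rw [abs_le] at h1 h2
  rw [abs_lt] at h3 ⊢
  constructor <;> linarith [h1.1, h1.2, h2.1, h2.2, h3.1, h3.2]
end

/-! ### Assembly of the almost sure limit. -/

/-- The weight bound at `k = N` gives `d_N / D_N ≤ C / N`, as the logarithmic factor is eventually
at least one. -/
theorem tendsto_totalWeight_succ_div {d : ℕ → ℝ} (hd : ∀ k, 1 ≤ k → 0 < d k)
    (hD : Tendsto (totalWeight d) atTop atTop) {ρ : ℝ} (hρ : 0 < ρ)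
    (hdD : d =O[atTop]
      (fun k : ℕ => totalWeight d k / ((k : ℝ) * (Real.log (totalWeight d k)) ^ ρ))) :
    Tendsto (fun n => totalWeight d (n + 1) / totalWeight d n) atTop (𝓝 1) := by
  obtain ⟨C, hC, hCb⟩ := exists_eventually_mul_weight_le hd hD hρ hdD
  have hlow : Tendsto (fun n : ℕ => 1 - C / ((n + 1 : ℕ) : ℝ)) atTop (𝓝 1) := by
    have h := (tendsto_const_nhds (x := C)).div_atTop
      (tendsto_natCast_atTop_atTop.comp (tendsto_add_atTop_nat 1))
    simpa [Function.comp_def] using h.const_sub 1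
  have hinv : Tendsto (fun n => totalWeight d n / totalWeight d (n + 1)) atTop (𝓝 1) := by
    have hC1 := (tendsto_add_atTop_nat 1).eventually hCb
    have hDe := (hD.comp (tendsto_add_atTop_nat 1)).eventually_ge_atTop (Real.exp 1)
    refine tendsto_of_tendsto_of_tendsto_of_le_of_le' hlow tendsto_const_nhds ?_ ?_
    · filter_upwards [hC1, hDe] with n hn he
      simp only [Function.comp_apply] at he
      have hD0 : 0 < totalWeight d (n + 1) := (Real.exp_pos 1).trans_le he
      have hlog : 1 ≤ Real.log (totalWeight d (n + 1)) := (Real.le_log_iff_exp_le hD0).2 he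
      have hn1 : (0 : ℝ) < ((n + 1 : ℕ) : ℝ) := by positivity
      have h1 : ((n + 1 : ℕ) : ℝ) * d (n + 1) ≤ C * totalWeight d (n + 1) := by
        refine (hn (n + 1) (by omega) le_rfl).trans ?_
        gcongr
        exact div_le_self hD0.le (Real.one_le_rpow hlog hρ.le)
      have hs : totalWeight d (n + 1) = totalWeight d n + d (n + 1) :=
        Finset.sum_Icc_succ_top (by omega) _
      have h2 : d (n + 1) ≤ C / ((n + 1 : ℕ) : ℝ) * totalWeight d (n + 1) := by
        rw [div_mul_eq_mul_div, le_div_iff₀ hn1]; linarith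
      rw [le_div_iff₀ hD0]
      linarith
    · filter_upwards [hDe] with n he
      exact div_le_one_of_le₀ (totalWeight_mono hd n.le_succ) ((Real.exp_pos 1).le.trans he)
  simpa using hinv.inv₀ one_ne_zero

theorem memLp_of_lintegral_enorm_pow_le {Ω : Type*} [MeasurableSpace Ω] {P : Measure Ω} {m : ℕ}
    (hm : m ≠ 0) {Z : Ω → ℝ} (hZ : Measurable Z)
    {M : ℝ≥0} (hM : ∫⁻ ω, ‖Z ω‖ₑ ^ m ∂P ≤ M) : MemLp Z m P := by
  refine ⟨hZ.aestronglyMeasurable, ?_⟩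
  rw [eLpNorm_lt_top_iff_lintegral_rpow_enorm_lt_top (by exact_mod_cast hm) (by simp)]
  simp only [ENNReal.toReal_natCast, ENNReal.rpow_natCast]
  exact hM.trans_lt ENNReal.coe_lt_top

section
variable {Ω : Type*} {X : ℕ → Ω → ℝ} {a b : ℕ → ℝ}
variable [MeasurableSpace Ω] {P : Measure Ω} [IsProbabilityMeasure P]

theorem ae_tendsto_weighted_average_of_nonneg (hX : ∀ i, Measurable (X i)) (hind : iIndepFun X P)
    (ha : ∀ n, 1 ≤ n → 0 < a n) {C β : ℝ} (hC : 0 < C) (hβ : 0 < β)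
    (hab : ∀ k l : ℕ, 1 ≤ k → k ≤ l → a k / a l ≤ C * ((k : ℝ) / (l : ℝ)) ^ β)
    {q : ℕ} (hq : 1 ≤ q) (hLp : ∀ k, MemLp (normSum X a b k) (2 * q : ℕ) P) {M : ℝ}
    (hM : ∀ k, 1 ≤ k → ∫ ω, normSum X a b k ω ^ (2 * q) ∂P ≤ M)
    {d : ℕ → ℝ} (hd : ∀ k, 1 ≤ k → 0 < d k) (hD : Tendsto (totalWeight d) atTop atTop)
    {ρ : ℝ} (hρ : 0 < ρ) (hρq : 1 < ρ * q) (hdD : d =O[atTop]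
      (fun k : ℕ => totalWeight d k / ((k : ℝ) * (Real.log (totalWeight d k)) ^ ρ)))
    {f : ℝ → ℝ} {K : ℝ≥0} (hf : LipschitzWith K f) (hf0 : ∀ x, 0 ≤ f x) {l : ℝ}
    (hl : Tendsto (fun n => ∫ ω, f (normSum X a b n ω) ∂P) atTop (𝓝 l)) :
    ∀ᵐ ω ∂P, Tendsto (fun N : ℕ => (∑ k ∈ Finset.Icc 1 N, d k * f (normSum X a b k ω))
      / totalWeight d N) atTop (𝓝 l) := by
  -- With `1 < σ < ρ q` and `1/σ < γ < 1`, the series of `j ^ (-γσ)` converges while the ratios of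
  -- consecutive `exp (j ^ γ)` still tend to one.
  obtain ⟨σ, hσ1, hσ⟩ := exists_between hρq
  have hσ0 : 0 < σ := by linarith
  obtain ⟨γ, hγσ, hγ1⟩ := exists_between (inv_lt_one_of_one_lt₀ hσ1)
  have hγ0 : 0 < γ := (inv_pos.2 hσ0).trans hγσ
  have hγσ1 : 1 < γ * σ := by rwa [← inv_mul_lt_iff₀' hσ0, mul_one]
  obtain ⟨A, hA, hAb⟩ := exists_integral_weighted_sum_pow_le hX hind ha hC hβ hab hq hLp hM hd hD
    hρ hdD hf hσ
  obtain ⟨c, hc, hcexp, hratio⟩ := exists_subseq_exp_rpow (totalWeight_mono hd)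
    (by simp [totalWeight]) hD (tendsto_totalWeight_succ_div hd hD hρ hdD) hγ0 hγ1
  have hDc : ∀ j, 0 < totalWeight d (c j) := fun j => (Real.exp_pos _).trans_le (hcexp j)
  set S : ℕ → Ω → ℝ := fun N ω => ∑ k ∈ Finset.Icc 1 N,
    d k * (f (normSum X a b k ω) - ∫ ω', f (normSum X a b k ω') ∂P) with hS
  have hSLp : ∀ N, MemLp (S N) (2 * q : ℕ) P := fun N => memLp_finsetSum _ fun k _ =>
    ((hf.memLp_comp (hLp k)).sub (memLp_const _)).const_mul (d k)
  have hconv : ∀ᵐ ω ∂P, Tendsto (fun j => S (c j) ω / totalWeight d (c j)) atTop (𝓝 0) := by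
    refine ae_tendsto_zero_of_summable_integral_pow (even_two_mul q)
      (B := fun j : ℕ => A * (j : ℝ) ^ (-(γ * σ))) (fun j => ?_) ?_ ?_
    · simp only [div_pow]
      exact ((hSLp (c j)).integrable_pow_of_le le_rfl).div_const _
    · exact (Real.summable_nat_rpow.2 (by linarith)).mul_left A
    · filter_upwards [hc.eventually hAb, eventually_gt_atTop 0] with j hj hj0
      have hj0' : (0 : ℝ) < j := by exact_mod_cast hj0
      have hlog : (j : ℝ) ^ γ ≤ Real.log (totalWeight d (c j)) :=
        (Real.le_log_iff_exp_le (hDc j)).2 (hcexp j)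
      have hpow : Real.log (totalWeight d (c j)) ^ (-σ) ≤ (j : ℝ) ^ (-(γ * σ)) := by
        calc _ ≤ ((j : ℝ) ^ γ) ^ (-σ) :=
              Real.rpow_le_rpow_of_nonpos (by positivity) hlog (by linarith)
          _ = _ := by rw [← Real.rpow_mul hj0'.le]; ring_nf
      simp only [div_pow]
      have hDp : 0 < totalWeight d (c j) ^ (2 * q) := pow_pos (hDc j) _
      rw [integral_div, div_le_iff₀ hDp]
      refine hj.trans ?_
      calc _ ≤ A * (totalWeight d (c j) ^ (2 * q) * (j : ℝ) ^ (-(γ * σ))) := by gcongr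
        _ = _ := by ring
  have hmean := (tendsto_weighted_average hd hD hl).comp hc
  filter_upwards [hconv] with ω hω
  refine tendsto_div_of_monotone_of_subseq (fun m n hmn => ?_) (fun n => ?_)
    (totalWeight_mono hd) (hD.eventually_gt_atTop 0) hc hratio ?_
  · exact Finset.sum_le_sum_of_subset_of_nonneg (Finset.Icc_subset_Icc_right hmn) fun k hk _ =>
      mul_nonneg (hd k (Finset.mem_Icc.1 hk).1).le (hf0 _)
  · exact Finset.sum_nonneg fun k hk =>
      mul_nonneg (hd k (Finset.mem_Icc.1 hk).1).le (hf0 _)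
  · have h := hω.add hmean
    rw [zero_add] at h
    refine h.congr fun j => ?_
    simp only [hS, Function.comp_apply, mul_sub, Finset.sum_sub_distrib]
    rw [← add_div, sub_add_cancel]

theorem integral_pow_le_of_lintegral_enorm_pow_le {m q : ℕ} (hm : m ≠ 0) (hqm : 2 * q ≤ m)
    {Z : Ω → ℝ} (hZ : Measurable Z) {M : ℝ≥0} (hM : ∫⁻ ω, ‖Z ω‖ₑ ^ m ∂P ≤ M) :
    ∫ ω, Z ω ^ (2 * q) ∂P ≤ 1 + M := by
  have hLp := memLp_of_lintegral_enorm_pow_le hm hZ hM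
  have hint : Integrable (fun ω => ‖Z ω ^ m‖) P := (hLp.integrable_pow_of_le le_rfl).norm
  have h1 : ∫ ω, ‖Z ω ^ m‖ ∂P ≤ M := by
    rw [integral_norm_eq_lintegral_enorm (hZ.pow_const m).aestronglyMeasurable]
    simp only [enorm_pow]
    exact ENNReal.toReal_le_coe_of_le_coe hM
  calc ∫ ω, Z ω ^ (2 * q) ∂P ≤ ∫ ω, (1 + ‖Z ω ^ m‖) ∂P := by
        refine integral_mono (hLp.integrable_pow_of_le hqm) ((integrable_const 1).add hint)
          fun ω => ?_
        simp only [norm_pow, Real.norm_eq_abs]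
        rw [← Even.pow_abs (even_two_mul q)]
        rcases le_total |Z ω| 1 with h | h
        · have := pow_le_one₀ (n := 2 * q) (abs_nonneg _) h
          have := pow_nonneg (abs_nonneg (Z ω)) m
          linarith
        · have := pow_le_pow_right₀ h hqm
          linarith
    _ = 1 + ∫ ω, ‖Z ω ^ m‖ ∂P := by rw [integral_add (integrable_const _) hint]; simp
    _ ≤ 1 + M := by gcongr
end

theorem theorem1 {Ω : Type*} [MeasurableSpace Ω] (P : Measure Ω) [IsProbabilityMeasure P]
    (X : ℕ → Ω → ℝ) (hX : ∀ i, Measurable (X i)) (hind : iIndepFun X P)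
    (a b d : ℕ → ℝ) (ha : ∀ n, 1 ≤ n → 0 < a n)
    (hd : ∀ k, 1 ≤ k → 0 < d k) (hD : Tendsto (totalWeight d) atTop atTop)
    -- convergence in law to the distribution `H`
    (H : Measure ℝ) [IsProbabilityMeasure H]
    (hC1 : TendstoInDistribution (fun n => normSum X a b n) atTop (id : ℝ → ℝ) (fun _ => P) H)
    -- size and monotonicity of the weights
    (hC2 : (fun k : ℕ => (k : ℝ) * d k) =O[atTop] (fun _ => (1 : ℝ)) ∨
      (fun k : ℕ => ((k : ℝ) * d k)⁻¹) =O[atTop] (fun _ => (1 : ℝ)))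
    (hC2' : ∃ α : ℝ, 0 < α ∧ α < 1 ∧
      ∃ k₀ : ℕ, AntitoneOn (fun k : ℕ => d k * (k : ℝ) ^ α) (Set.Ici k₀))
    (ρ : ℝ) (hρ : 0 < ρ)
    (hC3 : d =O[atTop]
      (fun k : ℕ => totalWeight d k / ((k : ℝ) * (Real.log (totalWeight d k)) ^ ρ)))
    -- growth of the normalization and bounded moments
    (hC4 : ∃ C β : ℝ, 0 < C ∧ 0 < β ∧
      ∀ k l : ℕ, 1 ≤ k → k ≤ l → a k / a l ≤ C * ((k : ℝ) / (l : ℝ)) ^ β)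
    (r : ℝ) (hr : 0 < r) (hrρ : r < ρ)
    (μ : ℕ) (hμ : max 2 (4 / (ρ - r)) ≤ (μ : ℝ))
    (hmom : ∃ M : ℝ≥0, ∀ n, 1 ≤ n → ∫⁻ ω, ‖normSum X a b n ω‖ₑ ^ μ ∂P ≤ M)
    (f : ℝ → ℝ) (hf : ∃ K : ℝ≥0, LipschitzWith K f) :
    Integrable f H ∧
      ∀ᵐ ω ∂P, Tendsto
        (fun N : ℕ => (totalWeight d N)⁻¹ * ∑ k ∈ Finset.Icc 1 N, d k * f (normSum X a b k ω))
        atTop (𝓝 (∫ x, f x ∂H)) := by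
  obtain ⟨C, β, hC, hβ, hab⟩ := hC4
  obtain ⟨M, hM⟩ := hmom
  obtain ⟨K, hK⟩ := hf
  have hμ2 : 2 ≤ μ := by exact_mod_cast (le_max_left _ _).trans hμ
  -- Half the largest even exponent not above `μ`. As `μ ≥ 2`, one has `μ ≤ 3q`, so `μ (ρ - r) ≥ 4`
  -- yields `ρ q > 4/3`.
  obtain ⟨q, hq⟩ : ∃ q, q = μ / 2 := ⟨_, rfl⟩
  have hq1 : 1 ≤ q := by omega
  have hqμ : 2 * q ≤ μ := by omega
  have hρq : 1 < ρ * q := by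
    have h1 : 4 ≤ μ * (ρ - r) := (div_le_iff₀ (by linarith)).1 ((le_max_right _ _).trans hμ)
    have h2 : (μ : ℝ) ≤ 3 * q := by exact_mod_cast (by omega : μ ≤ 3 * q)
    have h3 : (0 : ℝ) < μ := by exact_mod_cast (by omega : 0 < μ)
    nlinarith [mul_pos h3 hr]
  have hZm : ∀ n, Measurable (normSum X a b n) := measurable_normSum hX
  have hLp : ∀ n, MemLp (normSum X a b n) (2 * q : ℕ) P := by
    intro n
    rcases Nat.eq_zero_or_pos n with rfl | hn
    · have : normSum X a b 0 = fun _ => 0 / a 0 - b 0 := by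
        ext ω; simp [normSum, partialSum]
      rw [this]
      exact memLp_const _
    · exact (memLp_of_lintegral_enorm_pow_le (by omega) (hZm n) (hM n hn)).mono_exponent
        (by exact_mod_cast hqμ)
  have hMq : ∀ n, 1 ≤ n → ∫ ω, normSum X a b n ω ^ (2 * q) ∂P ≤ 1 + M := fun n hn =>
    integral_pow_le_of_lintegral_enorm_pow_le (by omega) hqμ (hZm n) (hM n hn)
  have hLp2 : ∀ n, MemLp (normSum X a b n) 2 P := fun n =>
    (hLp n).mono_exponent (by exact_mod_cast (by omega : 2 ≤ 2 * q))
  have hM2 : ∀ n, 1 ≤ n → ∫ ω, normSum X a b n ω ^ 2 ∂P ≤ 1 + (1 + M) := fun n hn =>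
    (integral_pow_le_one_add hq1 (hLp n)).trans (add_le_add_right (hMq n hn) 1)
  have hH := memLp_two_of_tendstoInDistribution hC1 hLp2 hM2
  have hint : ∀ {g : ℝ → ℝ}, LipschitzWith K g → Integrable g H := fun hg =>
    (hg.memLp_comp hH).integrable (by norm_num)
  have hmain : ∀ {g : ℝ → ℝ}, LipschitzWith K g → (∀ x, 0 ≤ g x) → ∀ᵐ ω ∂P,
      Tendsto (fun N : ℕ => (∑ k ∈ Finset.Icc 1 N, d k * g (normSum X a b k ω)) / totalWeight d N)
        atTop (𝓝 (∫ x, g x ∂H)) := fun hg hg0 =>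
    ae_tendsto_weighted_average_of_nonneg hX hind ha hC hβ hab hq1 hLp hMq hd hD hρ hρq hC3 hg hg0
      (tendsto_integral_lipschitz hC1 hLp2 hM2 hg)
  -- Interpolation needs monotone sums, hence the split into nonnegative parts, both again
  -- `K`-Lipschitz.
  have hpos : LipschitzWith K fun x => max (f x) 0 := hK.max_const 0
  have hneg : LipschitzWith K fun x => max (-f x) 0 := hK.neg.max_const 0
  refine ⟨hint hK, ?_⟩
  filter_upwards [hmain hpos fun x => le_max_right _ _, hmain hneg fun x => le_max_right _ _]
    with ω h1 h2
  have hdecomp : ∀ x, max (f x) 0 - max (-f x) 0 = f x := fun x => by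
    rcases le_total (f x) 0 with h | h
    · rw [max_eq_right h, max_eq_left (by linarith)]; ring
    · rw [max_eq_left h, max_eq_right (by linarith)]; ring
  have h3 := h1.sub h2
  rw [← integral_sub (hint hpos) (hint hneg)] at h3
  simp only [hdecomp] at h3
  refine h3.congr fun N => ?_
  rw [← sub_div, ← Finset.sum_sub_distrib, div_eq_inv_mul]
  congr 1
  exact Finset.sum_congr rfl fun k _ => by rw [← mul_sub, hdecomp]
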